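/- All graphs are finite, nonempty, simple and undirected. Write $v(G)$ for the number of nodes of $G$ and $c(F)$ for the number of connected components of $F$. **Convergence.** A pair $(G,d)$ is *admissible* if $d\ge 1$ and all degrees of $G$ are at most $d$. Put $$t(F,G,d)=\frac{\hom(F,G)}{v(G)^{c(F)}\,d^{\,v(F)-c(F)}} .$$ A sequence $(G_n,d_n)$ of admissible pairs is *convergent* if $t(F,G_n,d_n)$ converges for every graph $F$. **Graphonings.** A *graphoning* is a tuple $\mathbf G=(X,\mathcal B,\lambda,\mu,W)$ where $(X,\mathcal B,\lambda)$ is a probability space, $\mu:\mathcal B\to[0,\infty]$ is a measure and $W:X^2\to[0,1]$ is symmetric and $\mathcal B\otimes\mathcal B$-measurable, such that, with $\deg_A(x)=\int_A W(x,y)\,d\mu(y)$: $\deg_X(x)\le 1$ for all $x\in X$; $\deg_A$ is measurable for all $A\in\mathcal B$; and $\int_A\deg_B\,d\lambda=\int_B\deg_A\,d\lambda$ for all $A,B\in\mathcal B$. Let $\deg(x)$ be the measure $A\mapsto\deg_A(x)$. For a connected graph $F$, label the nodes by $0,\dots,m$, $m=v(F)-1$, so that each node $i\ge1$ has a neighbor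 $j(i)<i$; let $T$ be the spanning tree with edges $(i,j(i))$, and put $$t(F,\mathbf G)=\int_X\int_X\cdots\int_X\prod_{kl\in E(F)\setminus E(T)}W(x_k,x_l)\;d\deg(x_{j(m)})(x_m)\cdots d\deg(x_{j(1)})(x_1)\,d\lambda(x_0),$$ which does not depend on the choices made. **Euclidean limits.** A *gauge function* $h$ is nonnegative, nondecreasing and right-continuous on some $[0,\varepsilon)$, $\varepsilon>0$; the associated Hausdorff measure is $\mu_h(B)=\lim_{\delta\to0}\inf\{\sum_i h(\operatorname{diam} I_i): B\subseteq\bigcup_i I_i,\ \operatorname{diam} I_i<\delta\}$ (countable covers by nonempty sets). A graphoning $\mathbf G$ is a *Euclidean limit* of a convergent sequence $(G_n,d_n)$, with gauge function $h$, if $X=[0,1]$ with the Euclidean metric and its Borel sets, $\lambda$ is one-dimensional Hausdorff (i.e. Lebesgue) measure, $\mu=\mu_h$, $t(F,G_n,d_n)\to t(F,\mathbf G)$ for all connected graphs $F$, and $h(1/v(G_n))\sim 1/d_n$ as $n\to\infty$. **The two examples.** Let $h_{\rm cube}(x)=1/\log_2(1/x)$ (with $h_{\rm cube}(0)=0$)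 and $h_{\rm proj}(x)=\sqrt{2x}$, and let $$S_{\rm cube}=\Big\{\sum_{j\ge1}a_j2^{-j}: a_j\in\{0,1\},\ a_1=a_2,\ a_3=a_4,\ a_5=\dots=a_8,\ a_9=\dots=a_{16},\dots\Big\},$$ $$S_{\rm proj}=\Big\{\sum_{j\ge1}a_j2^{-j}: a_j\in\{0,1\},\ a_1=a_2=a_3,\ a_4=a_5,\ a_6=a_7,\ a_8=a_9,\dots\Big\}.$$ Let $\mathbf G_{\rm cube}$ and $\mathbf G_{\rm proj}$ be the tuples $([0,1],\mathcal B,\lambda,\mu_h,W)$, where $\lambda$ is Lebesgue measure on the Borel sets $\mathcal B$, $h=h_{\rm cube}$, resp. $h=h_{\rm proj}$, and $W(x,y)=1$ if $|x-y|\in S$, $W(x,y)=0$ otherwise, with $S=S_{\rm cube}$, resp. $S=S_{\rm proj}$. **Proposition.** (a) $\mu_{h_{\rm cube}}(S_{\rm cube})=1$, the tuple $\mathbf G_{\rm cube}$ is a graphoning, the sequence $(Q_d,d)_{d\ge1}$ of hypercube graphs $Q_d$ on $\{0,1\}^d$ is convergent, and $\mathbf G_{\rm cube}$ is a Euclidean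 limit of it with gauge function $h_{\rm cube}$. (b) $\mu_{h_{\rm proj}}(S_{\rm proj})=1$, and if $G_n$ is the point-line incidence graph of a finite projective plane of order $q_n$, with $q_n\to\infty$, then $\mathbf G_{\rm proj}$ is a graphoning, the sequence $(G_n,q_n+1)$ is convergent, and $\mathbf G_{\rm proj}$ is a Euclidean limit of it with gauge function $h_{\rm proj}$. -/

import Mathlib

open MeasureTheory Filter Topology
open scoped ENNReal

namespace GraphLimits

noncomputable section

/-! ### Homomorphism densities of finite graphs -/

/-- `(G, d)` is an admissible pair: `G` is a finite (nonempty, simple) graph, `d ≥ 1`, and all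
degrees of `G` are at most `d`. -/
structure IsAdmissible {V : Type*} (G : SimpleGraph V) (d : ℝ) : Prop where
  finite : Finite V
  nonempty : Nonempty V
  one_le : 1 ≤ d
  degree_le : ∀ v, ((G.neighborSet v).ncard : ℝ) ≤ d

/-- The homomorphism density `t(F, G, d) = hom(F, G) / (v(G) ^ c(F) * d ^ (v(F) - c(F)))`, where
`c(F)` is the number of connected components of `F` (note that `c(F) ≤ v(F)`). For connected `F`
this is `hom(F, G) / (v(G) * d ^ (v(F) - 1))`. -/
def homDensity {U V : Type*} (F : SimpleGraph U) (G : SimpleGraph V) (d : ℝ) : ℝ :=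
  (Nat.card (F →g G) : ℝ) /
    ((Nat.card V : ℝ) ^ Nat.card F.ConnectedComponent *
      d ^ (Nat.card U - Nat.card F.ConnectedComponent))

/-- An admissible sequence `(G n, d n)` is convergent if `t(F, G n, d n)` converges for every
finite graph `F`. -/
structure IsConvergentSeq {V : ℕ → Type*} (G : ∀ n, SimpleGraph (V n)) (d : ℕ → ℝ) : Prop where
  admissible : ∀ n, IsAdmissible (G n) (d n)
  convergent : ∀ (U : Type) [Finite U] (F : SimpleGraph U),
    ∃ l : ℝ, Tendsto (fun n => homDensity F (G n) (d n)) atTop (𝓝 l)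

/-! ### Graphonings and pseudo-graphonings -/

/-- The data `(X, 𝓑, λ, μ, W)` of a graphoning. -/
structure GraphoningData (X : Type*) [MeasurableSpace X] where
  lam : Measure X
  mu : Measure X
  W : X → X → ℝ

/-- The data `(X, 𝓑, λ, W, deg)` of a pseudo-graphoning. -/
structure PseudoGraphoningData (X : Type*) [MeasurableSpace X] where
  lam : Measure X
  W : X → X → ℝ
  deg : X → Measure X

variable {X : Type*} [MeasurableSpace X]

/-- `deg_A(x) = ∫_A W(x, y) dμ(y)`. -/
def GraphoningData.degree (D : GraphoningData X) (A : Set X) (x : X) : ℝ≥0∞ :=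
  ∫⁻ y in A, ENNReal.ofReal (D.W x y) ∂D.mu

/-- The axioms of a graphoning. -/
structure GraphoningData.IsGraphoning (D : GraphoningData X) : Prop where
  prob : IsProbabilityMeasure D.lam
  W_measurable : Measurable (fun p : X × X => D.W p.1 p.2)
  W_mem : ∀ x y, D.W x y ∈ Set.Icc (0 : ℝ) 1
  W_symm : ∀ x y, D.W x y = D.W y x
  degree_bound : ∀ x, D.degree Set.univ x ≤ 1
  degree_measurable : ∀ A, MeasurableSet A → Measurable (D.degree A)
  measure_preserving : ∀ A B, MeasurableSet A → MeasurableSet B →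
    ∫⁻ x in A, D.degree B x ∂D.lam = ∫⁻ x in B, D.degree A x ∂D.lam

/-- The axioms of a pseudo-graphoning: `deg` is a sub-Markov kernel, reversible with respect to the
probability measure `λ`, and compatible with the symmetric measurable function `W`. -/
structure PseudoGraphoningData.IsPseudoGraphoning (P : PseudoGraphoningData X) : Prop where
  prob : IsProbabilityMeasure P.lam
  W_measurable : Measurable (fun p : X × X => P.W p.1 p.2)
  W_mem : ∀ x y, P.W x y ∈ Set.Icc (0 : ℝ) 1
  W_symm : ∀ x y, P.W x y = P.W y x
  deg_le_one : ∀ x, P.deg x Set.univ ≤ 1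
  deg_measurable : ∀ A, MeasurableSet A → Measurable (fun x => P.deg x A)
  reversible : ∀ A B, MeasurableSet A → MeasurableSet B →
    ∫⁻ x in A, P.deg x B ∂P.lam = ∫⁻ x in B, P.deg x A ∂P.lam
  compatible : ∀ x₁ x₂ A, MeasurableSet A →
    ∫⁻ y in A, ENNReal.ofReal (P.W x₂ y) ∂(P.deg x₁) =
      ∫⁻ y in A, ENNReal.ofReal (P.W x₁ y) ∂(P.deg x₂)

/-- A graphoning viewed as a pseudo-graphoning: `deg(x)` is the measure `A ↦ deg_A(x)`. -/
def GraphoningData.toPseudo (D : GraphoningData X) : PseudoGraphoningData X where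
  lam := D.lam
  W := D.W
  deg x := D.mu.withDensity (fun y => ENNReal.ofReal (D.W x y))

theorem GraphoningData.toPseudo_deg (D : GraphoningData X) (x : X) {A : Set X}
    (hA : MeasurableSet A) : D.toPseudo.deg x A = D.degree A x :=
  withDensity_apply _ hA

theorem GraphoningData.IsGraphoning.isPseudoGraphoning {D : GraphoningData X}
    (h : D.IsGraphoning) : D.toPseudo.IsPseudoGraphoning where
  prob := h.prob
  W_measurable := h.W_measurable
  W_mem := h.W_mem
  W_symm := h.W_symm
  deg_le_one x := by
    rw [D.toPseudo_deg x MeasurableSet.univ]; exact h.degree_bound x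
  deg_measurable A hA := by
    simp only [D.toPseudo_deg _ hA]; exact h.degree_measurable A hA
  reversible A B hA hB := by
    simp only [D.toPseudo_deg _ hA, D.toPseudo_deg _ hB]
    exact h.measure_preserving A B hA hB
  compatible x₁ x₂ A hA := by
    have hm : ∀ x, Measurable (fun y => ENNReal.ofReal (D.W x y)) := fun x =>
      (h.W_measurable.comp measurable_prodMk_left).ennreal_ofReal
    simp only [GraphoningData.toPseudo]
    rw [setLIntegral_withDensity_eq_setLIntegral_mul _ (hm x₁) (hm x₂) hA,
      setLIntegral_withDensity_eq_setLIntegral_mul _ (hm x₂) (hm x₁) hA, mul_comm]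

/-! ### Homomorphism densities of pseudo-graphonings -/

/-- An admissible labeling of a graph `F` by `0, 1, …, v(F) - 1`, together with a choice, for each
node `v` with positive label, of a neighbor `parent v` with smaller label. (Such a choice exists if
and only if for every `i ≥ 1` the nodes with label `< i` span a connected subgraph.) The edges
`(v, parent v)` form a spanning tree of `F`. -/
structure AdmissibleLabeling {U : Type*} [Fintype U] (F : SimpleGraph U) where
  label : U ≃ Fin (Fintype.card U)
  parent : U → U
  parent_adj : ∀ v, 0 < (label v : ℕ) → F.Adj (parent v) v
  parent_lt : ∀ v, 0 < (label v : ℕ) → label (parent v) < label v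

theorem AdmissibleLabeling.nonempty {U : Type*} [Fintype U] {F : SimpleGraph U}
    (hF : F.Connected) : Nonempty (AdmissibleLabeling F) := by
  classical
  obtain ⟨o⟩ := hF.nonempty
  let e := Fintype.equivFin U
  let f : Fin (Fintype.card U) → ℕ := fun i => F.dist o (e.symm i)
  let σ := Tuple.sort f
  have hσ : Monotone (f ∘ σ) := Tuple.monotone_sort f
  let lab : U ≃ Fin (Fintype.card U) := e.trans σ.symm
  have hlab : ∀ u v, lab u ≤ lab v → F.dist o u ≤ F.dist o v := by
    intro u v h
    simpa [f, lab] using hσ h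
  have hpar : ∀ v, v ≠ o → ∃ w, F.Adj w v ∧ F.dist o w < F.dist o v := by
    intro v hv
    obtain ⟨p, hp⟩ := hF.exists_walk_length_eq_dist v o
    cases p with
    | nil => exact absurd rfl hv
    | @cons _ w _ hvw q =>
      refine ⟨w, hvw.symm, ?_⟩
      have h1 := SimpleGraph.dist_le q
      rw [SimpleGraph.Walk.length_cons] at hp
      rw [SimpleGraph.dist_comm, SimpleGraph.dist_comm (u := o) (v := v)]
      omega
  have hroot : ∀ v, 0 < (lab v : ℕ) → v ≠ o := by
    rintro v hv rfl
    let z : Fin (Fintype.card U) := ⟨0, Fintype.card_pos_iff.mpr ⟨v⟩⟩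
    have h0 : F.dist v (lab.symm z) ≤ F.dist v v := by
      refine hlab _ _ ?_
      rw [Equiv.apply_symm_apply]
      exact Fin.mk_le_of_le_val (Nat.zero_le _)
    have h1 : F.dist v (lab.symm z) = 0 := by simpa using h0
    have h2 := (hF.dist_eq_zero_iff).mp h1
    have h3 : lab v = z := by
      have := congrArg lab h2
      simpa using this
    rw [h3] at hv
    exact absurd hv (lt_irrefl 0)
  choose! par hadj hlt using hpar
  refine ⟨⟨lab, par, fun v hv => hadj v (hroot v hv), fun v hv => ?_⟩⟩
  by_contra hcon
  exact absurd (hlab _ _ (not_lt.mp hcon)) (not_le.mpr (hlt v (hroot v hv)))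

/-- The nodes with labels `1, 2, …, v(F) - 1`, in this order. -/
def AdmissibleLabeling.nonrootNodes {U : Type*} [Fintype U] {F : SimpleGraph U}
    (L : AdmissibleLabeling F) : List U :=
  (List.finRange (Fintype.card U)).tail.map L.label.symm

/-- For a list of nodes `v₁, …, v_m`, the iterated integral
`∫ ⋯ ∫ f(x) d deg(x_{parent v_m})(x_{v_m}) ⋯ d deg(x_{parent v₁})(x_{v₁})`; the integral over
`x_{v₁}` is the outermost one. The coordinates of nodes not in the list are fixed. -/
def iteratedIntegral {U : Type*} [DecidableEq U] (deg : X → Measure X) (parent : U → U)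
    (f : (U → X) → ℝ≥0∞) : List U → (U → X) → ℝ≥0∞
  | [], x => f x
  | v :: l, x => ∫⁻ y, iteratedIntegral deg parent f l (Function.update x v y) ∂(deg (x (parent v)))

open Classical in
/-- The rooted homomorphism density `t((F, o), (P, x₀))`, computed with the admissible labeling `L`;
the root `o` is the node with label `0`. The product is over the edges of `F` that do not belong to
the spanning tree, each edge being listed once with the endpoint of smaller label first. -/
def PseudoGraphoningData.rootedDensity {U : Type*} [Fintype U] (P : PseudoGraphoningData X)
    {F : SimpleGraph U} (L : AdmissibleLabeling F) (x₀ : X) : ℝ≥0∞ :=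
  iteratedIntegral P.deg L.parent
    (fun x => ∏ e : U × U with
        F.Adj e.1 e.2 ∧ L.label e.1 < L.label e.2 ∧ e.1 ≠ L.parent e.2,
      ENNReal.ofReal (P.W (x e.1) (x e.2)))
    L.nonrootNodes (fun _ => x₀)

/-- The homomorphism density `t(F, P) = ∫ t((F, o), (P, x₀)) dλ(x₀)` of a connected graph `F` in a
pseudo-graphoning `P`, computed with the admissible labeling `L` of `F`. -/
def PseudoGraphoningData.density {U : Type*} [Fintype U] (P : PseudoGraphoningData X)
    {F : SimpleGraph U} (L : AdmissibleLabeling F) : ℝ≥0∞ :=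
  ∫⁻ x₀, P.rootedDensity L x₀ ∂P.lam

/-- `P` is a limit of the convergent sequence `(G n, d n)`: it is a pseudo-graphoning, and
`t(F, G n, d n) → t(F, P)` for all connected finite graphs `F` (whatever root, admissible labeling
and spanning tree are used to compute `t(F, P)`). -/
structure IsLimit {V : ℕ → Type*} (G : ∀ n, SimpleGraph (V n)) (d : ℕ → ℝ)
    (P : PseudoGraphoningData X) : Prop where
  convergentSeq : IsConvergentSeq G d
  pseudo : P.IsPseudoGraphoning
  tendsto : ∀ (U : Type) [Fintype U] (F : SimpleGraph U), F.Connected →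
    ∀ L : AdmissibleLabeling F,
      Tendsto (fun n => ENNReal.ofReal (homDensity F (G n) (d n))) atTop (𝓝 (P.density L))

/-! ### Hausdorff and Euclidean graphonings and limits -/

/-- `h` is a gauge function: on some right neighborhood `[0, ε)` of `0` it is nonnegative,
nondecreasing and right-continuous. -/
def IsGauge (h : ℝ → ℝ) : Prop :=
  ∃ ε > 0, (∀ x ∈ Set.Ico 0 ε, 0 ≤ h x) ∧ MonotoneOn h (Set.Ico 0 ε) ∧
    ∀ x ∈ Set.Ico 0 ε, ContinuousWithinAt h (Set.Ici x) x

/-- The Hausdorff measure with gauge function `h`: the limit as `δ → 0` of the infimum of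
`∑ h(diam I_i)` over the countable covers by sets `I_i` of diameter at most `δ`. -/
def gaugeMeasure (Y : Type*) [MetricSpace Y] [MeasurableSpace Y] [BorelSpace Y] (h : ℝ → ℝ) :
    Measure Y :=
  Measure.mkMetric (fun r : ℝ≥0∞ => ENNReal.ofReal (h r.toReal))

/-- `D` is a Hausdorff graphoning with gauge function `h`. -/
structure GraphoningData.IsHausdorff {Y : Type*} [MetricSpace Y] [MeasurableSpace Y] [BorelSpace Y]
    (D : GraphoningData Y) (h : ℝ → ℝ) : Prop where
  graphoning : D.IsGraphoning
  gauge : IsGauge h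
  lam_eq : D.lam = μH[1]
  mu_eq : D.mu = gaugeMeasure Y h

/-- `D` is a Euclidean limit of `(G n, d n)`, with gauge function `h`: `D` is a limit of the
convergent sequence `(G n, d n)`, it is a Hausdorff graphoning on `[0, 1]` with the Euclidean metric
with gauge function `h`, and `h(1 / v(G n)) ∼ 1 / d n`. -/
structure IsEuclideanLimit {V : ℕ → Type*} (G : ∀ n, SimpleGraph (V n)) (d : ℕ → ℝ)
    (D : GraphoningData unitInterval) (h : ℝ → ℝ) : Prop where
  limit : IsLimit G d D.toPseudo
  euclidean : D.IsHausdorff h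
  growth : Asymptotics.IsEquivalent atTop
    (fun n => h (1 / (Nat.card (V n) : ℝ))) (fun n => 1 / d n)

/-! ### The two examples -/

/-- The hypercube graph `Q_d` on `{0, 1}^d`. -/
def hypercube (d : ℕ) : SimpleGraph (Fin d → Fin 2) where
  Adj x y := hammingDist x y = 1
  symm := ⟨fun x y h => by rwa [hammingDist_comm]⟩
  loopless := ⟨fun x h => by simp at h⟩

/-- The bipartite point-line incidence graph. -/
def incidenceGraph (P L : Type*) [Membership P L] : SimpleGraph (P ⊕ L) :=
  SimpleGraph.fromRel fun a b =>
    match a, b with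
    | Sum.inl p, Sum.inr l => p ∈ l
    | _, _ => False

/-- The gauge function `1 / log₂ (1 / x)` (its value at `0` is `0`). -/
def hCube (x : ℝ) : ℝ := 1 / Real.logb 2 (1 / x)

/-- The gauge function `√(2 x)`. -/
def hProj (x : ℝ) : ℝ := √(2 * x)

/-- The numbers `∑_{j ≥ 1} a_j 2^{-j}` with binary digits satisfying `a_1 = a_2`, `a_3 = a_4`,
`a_5 = ⋯ = a_8`, `a_9 = ⋯ = a_16`, …. -/
def SCube : Set ℝ :=
  {s | ∃ a : ℕ → Fin 2, a 1 = a 2 ∧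
    (∀ k ≥ 1, ∀ i ∈ Set.Ioc (2 ^ k) (2 ^ (k + 1)), ∀ j ∈ Set.Ioc (2 ^ k) (2 ^ (k + 1)),
      a i = a j) ∧
    HasSum (fun j : ℕ => ((a (j + 1) : ℕ) : ℝ) * (1 / 2) ^ (j + 1)) s}

/-- The numbers `∑_{j ≥ 1} a_j 2^{-j}` with binary digits satisfying `a_1 = a_2 = a_3`,
`a_4 = a_5`, `a_6 = a_7`, `a_8 = a_9`, …. -/
def SProj : Set ℝ :=
  {s | ∃ a : ℕ → Fin 2, a 1 = a 2 ∧ a 2 = a 3 ∧ (∀ k ≥ 2, a (2 * k) = a (2 * k + 1)) ∧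
    HasSum (fun j : ℕ => ((a (j + 1) : ℕ) : ℝ) * (1 / 2) ^ (j + 1)) s}

/-- The tuple `([0, 1], 𝓑, λ, μ, W)` with `λ` Lebesgue measure, `μ` the Hausdorff measure with gauge
function `h`, and `W(x, y) = 1` if `|x - y| ∈ S` and `W(x, y) = 0` otherwise. -/
def differenceGraphoning (S : Set ℝ) (h : ℝ → ℝ) : GraphoningData unitInterval where
  lam := volume
  mu := gaugeMeasure unitInterval h
  W x y := S.indicator (fun _ => (1 : ℝ)) |(x : ℝ) - (y : ℝ)|

end

end GraphLimits

namespace GraphLimits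

/-! ### Iterated integrals over a tree -/

section Iterated

variable {X : Type*} [MeasurableSpace X] {U : Type*}

/-! Both sequences consist of d-regular graphs in which two distinct nodes have at most two common
neighbors, with d → ∞. In such a sequence trees have density 1 and all other connected graphs have
density tending to 0. Indeed, if a non-tree edge joins `k` to a later node `v`, then x_v, a random
neighbor of x_{parent v}, must also be adjacent to x_k. This has probability at most 2/d unless x_k
= x_{parent v}, and that coincidence has probability at most 1/d. The graphonings obey the same
rule, with "rational difference" in place of equality and 0 in place of 2/d, so the one estimate
`density_le_of_nontree` serves both sides. Disconnected graphs follow by multiplicativity.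

The rest is the geometry of S. With e_k = 2^{-M_k} for the block boundaries M_k, S is the Cantor set
of sums ∑ b_k (e_k - e_{k+1}) with bits b_k, and h(e_k) = 2^{-k} for k ≥ 1. Covers by cylinders give
μ_h(S) ≤ 1; a concavity property of h gives the reverse bound by the mass distribution principle. So
μ_h restricted to S is the law of uniform random bits (`restrict_cantorSet`). The symmetry s ↦ 1 - s
of S makes all degrees 1 (`degree_univ`), and translation invariance of Lebesgue measure gives
reversibility (`setLIntegral_degree`).

Since 4 e_{k+1} ≤ e_k, a number has at most one expansion with coefficients in {-1, 0, 1}. For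
irrational t such an expansion has infinitely many nonzero coefficients, and each of them fixes a
bit, so S ∩ (S + t) is null (`gaugeMeasure_inter_translate`). Hence points with irrational
difference have common neighborhoods of measure zero. -/

theorem iteratedIntegral_append [DecidableEq U] (deg : X → Measure X) (parent : U → U)
    (f : (U → X) → ℝ≥0∞) (l₁ l₂ : List U) :
    iteratedIntegral deg parent f (l₁ ++ l₂) =
      iteratedIntegral deg parent (iteratedIntegral deg parent f l₂) l₁ := by
  induction l₁ with
  | nil => rfl
  | cons v l ih =>
    funext x
    simp only [List.cons_append, iteratedIntegral, ih]

theorem iteratedIntegral_mono [DecidableEq U] (deg : X → Measure X) (parent : U → U)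
    {f g : (U → X) → ℝ≥0∞} (hfg : ∀ x, f x ≤ g x) (l : List U) (x : U → X) :
    iteratedIntegral deg parent f l x ≤ iteratedIntegral deg parent g l x := by
  induction l generalizing x with
  | nil => exact hfg x
  | cons v l ih => exact lintegral_mono fun y => ih _

theorem iteratedIntegral_const [DecidableEq U] {deg : X → Measure X}
    (hdeg : ∀ x, deg x Set.univ = 1) (parent : U → U) (l : List U) (x : U → X) (c : ℝ≥0∞) :
    iteratedIntegral deg parent (fun _ => c) l x = c := by
  induction l generalizing x with
  | nil => rfl
  | cons v l ih => simp [iteratedIntegral, ih, hdeg]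

/-- Measurability of `f` is not needed: splitting an integral requires it for one summand only, here
the constant. Total mass at most 1 keeps the constant from growing. -/
theorem iteratedIntegral_const_add_le [DecidableEq U] {deg : X → Measure X}
    (hdeg : ∀ x, deg x Set.univ ≤ 1) (parent : U → U) (l : List U) (x : U → X) (c : ℝ≥0∞)
    (f : (U → X) → ℝ≥0∞) :
    iteratedIntegral deg parent (fun x => c + f x) l x ≤ c + iteratedIntegral deg parent f l x := by
  induction l generalizing x with
  | nil => exact le_rfl
  | cons v l ih =>
    calc iteratedIntegral deg parent (fun x => c + f x) (v :: l) x
        ≤ ∫⁻ y, (c + iteratedIntegral deg parent f l (Function.update x v y))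
            ∂(deg (x (parent v))) := lintegral_mono fun y => ih _
      _ = c * deg (x (parent v)) Set.univ + iteratedIntegral deg parent f (v :: l) x := by
          rw [lintegral_add_left measurable_const, lintegral_const]; rfl
      _ ≤ c + iteratedIntegral deg parent f (v :: l) x := by
          gcongr
          exact mul_le_of_le_one_right' (hdeg _)

theorem iteratedIntegral_le_const [DecidableEq U] {deg : X → Measure X}
    (hdeg : ∀ x, deg x Set.univ ≤ 1) (parent : U → U) (l : List U) (x : U → X) {c : ℝ≥0∞}
    {f : (U → X) → ℝ≥0∞} (hf : ∀ x, f x ≤ c) : iteratedIntegral deg parent f l x ≤ c := by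
  refine (iteratedIntegral_mono deg parent (g := fun x => c + 0)
    (fun x => (hf x).trans (le_add_right le_rfl)) l x).trans
    ((iteratedIntegral_const_add_le hdeg parent l x c fun _ => 0).trans ?_)
  have : ∀ x, iteratedIntegral deg parent (fun _ => 0) l x = 0 := by
    induction l with
    | nil => intro x; rfl
    | cons v l ih => intro x; simp [iteratedIntegral, ih]
  simp [this]

/-- Integrating out coordinates on which the integrand does not depend. -/
theorem iteratedIntegral_le_self [DecidableEq U] {deg : X → Measure X}
    (hdeg : ∀ x, deg x Set.univ ≤ 1) (parent : U → U) (l : List U) {f : (U → X) → ℝ≥0∞}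
    (hf : ∀ v ∈ l, ∀ x y, f (Function.update x v y) = f x) (x : U → X) :
    iteratedIntegral deg parent f l x ≤ f x := by
  induction l generalizing x with
  | nil => exact le_rfl
  | cons v l ih =>
    calc iteratedIntegral deg parent f (v :: l) x
        ≤ ∫⁻ y, f x ∂(deg (x (parent v))) := by
          refine lintegral_mono fun y => ?_
          refine (ih (fun w hw => hf w (List.mem_cons_of_mem _ hw)) _).trans ?_
          rw [hf v List.mem_cons_self]
      _ ≤ f x := by
          rw [lintegral_const]
          exact mul_le_of_le_one_right' (hdeg _)

/-- The iterated integral of the indicator function of a relation between a coordinate `v` and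
another coordinate `k` that is integrated earlier. -/
theorem iteratedIntegral_rel_le [DecidableEq U] {deg : X → Measure X}
    (hdeg : ∀ x, deg x Set.univ ≤ 1) (parent : U → U) {v k : U} {l : List U}
    (hv : v ∉ l) (hk : k ∉ v :: l) (R : X → X → Prop) (x : U → X) :
    iteratedIntegral deg parent (fun x => {y | R (x k) y}.indicator (fun _ => 1) (x v)) (v :: l) x ≤
      deg (x (parent v)) {y | R (x k) y} := by
  have hkv : k ≠ v := fun h => hk (h ▸ List.mem_cons_self)
  have hkl : k ∉ l := fun h => hk (List.mem_cons_of_mem _ h)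
  calc _ ≤ ∫⁻ y, {y | R (x k) y}.indicator (fun _ => 1) y ∂(deg (x (parent v))) := by
        refine lintegral_mono fun y => ?_
        refine (iteratedIntegral_le_self hdeg parent l ?_ _).trans ?_
        · intro w hw z y
          rw [Function.update_of_ne (ne_of_mem_of_not_mem hw hkl).symm,
            Function.update_of_ne (ne_of_mem_of_not_mem hw hv).symm]
        · rw [Function.update_of_ne hkv, Function.update_self]
    -- Valid for non-measurable relations as well.
    _ ≤ _ := lintegral_indicator_one_le _

/-! ### Admissible labelings; densities of trees and of non-trees -/

variable [Fintype U] {F : SimpleGraph U} (L : AdmissibleLabeling F)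

theorem AdmissibleLabeling.mem_nonrootNodes {v : U} :
    v ∈ L.nonrootNodes ↔ 0 < (L.label v : ℕ) := by
  have hn : 0 < Fintype.card U := Fintype.card_pos_iff.mpr ⟨v⟩
  obtain ⟨n, hn'⟩ : ∃ n, Fintype.card U = n + 1 := ⟨_, (Nat.sub_add_cancel hn).symm⟩
  rw [AdmissibleLabeling.nonrootNodes, List.mem_map]
  have key : ∀ i : Fin (Fintype.card U), i ∈ (List.finRange (Fintype.card U)).tail ↔
      0 < (i : ℕ) := by
    rw [hn']
    intro i
    rw [List.finRange_succ, List.tail_cons, List.mem_map]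
    constructor
    · rintro ⟨j, -, rfl⟩; simp
    · intro hi
      obtain ⟨j, rfl⟩ := Fin.exists_succ_eq.mpr (Fin.pos_iff_ne_zero.mp (Fin.lt_def.mpr hi))
      exact ⟨j, List.mem_finRange j, rfl⟩
  constructor
  · rintro ⟨i, hi, rfl⟩
    simpa using (key i).1 hi
  · intro h
    exact ⟨L.label v, (key _).2 h, by simp⟩

theorem AdmissibleLabeling.pairwise_nonrootNodes :
    L.nonrootNodes.Pairwise fun u v => L.label u < L.label v := by
  rw [AdmissibleLabeling.nonrootNodes, List.pairwise_map]
  refine List.Pairwise.sublist (List.tail_sublist _) ?_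
  simpa using List.pairwise_lt_finRange (Fintype.card U)

theorem AdmissibleLabeling.length_nonrootNodes :
    L.nonrootNodes.length = Fintype.card U - 1 := by
  simp [AdmissibleLabeling.nonrootNodes]

/-- The list of nonroot nodes splits at every nonroot node into the nodes with smaller label and
those with larger label. -/
theorem AdmissibleLabeling.exists_split {v : U} (hv : 0 < (L.label v : ℕ)) :
    ∃ l₁ l₂, L.nonrootNodes = l₁ ++ v :: l₂ ∧
      (∀ u ∈ l₂, L.label v < L.label u) ∧
      (∀ u, u ∈ l₁ ↔ 0 < (L.label u : ℕ) ∧ L.label u < L.label v) ∧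
      l₁.Pairwise (fun u v => L.label u < L.label v) := by
  obtain ⟨l₁, l₂, h⟩ := List.append_of_mem (L.mem_nonrootNodes.2 hv)
  have hp := L.pairwise_nonrootNodes
  rw [h, List.pairwise_append, List.pairwise_cons] at hp
  obtain ⟨h1, ⟨h2, -⟩, h4⟩ := hp
  refine ⟨l₁, l₂, h, h2, fun u => ⟨fun hu => ⟨?_, h4 u hu v List.mem_cons_self⟩, ?_⟩, h1⟩
  · rw [← L.mem_nonrootNodes, h]
    exact List.mem_append_left _ hu
  · rintro ⟨hu0, huv⟩
    rw [← L.mem_nonrootNodes, h, List.mem_append, List.mem_cons] at hu0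
    rcases hu0 with hu | rfl | hu
    · exact hu
    · exact absurd huv (lt_irrefl _)
    · exact absurd (h2 u hu) huv.not_gt

/-- The pairs of adjacent nodes, with the node of smaller label first, that are not edges of the
spanning tree given by the labeling. -/
def AdmissibleLabeling.IsNontree (e : U × U) : Prop :=
  F.Adj e.1 e.2 ∧ L.label e.1 < L.label e.2 ∧ e.1 ≠ L.parent e.2

/-- The integrand is an empty product, so 1 is integrated against probability measures. -/
theorem PseudoGraphoningData.density_eq_one_of_tree {P : PseudoGraphoningData X}
    (hlam : P.lam Set.univ = 1) (hdeg : ∀ x, P.deg x Set.univ = 1)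
    (hL : ∀ e, ¬ L.IsNontree e) : P.density L = 1 := by
  classical
  have h : ∀ x, P.rootedDensity L x = 1 := by
    intro x
    rw [PseudoGraphoningData.rootedDensity]
    have h2 : (Finset.univ.filter fun e : U × U =>
        F.Adj e.1 e.2 ∧ L.label e.1 < L.label e.2 ∧ e.1 ≠ L.parent e.2) = ∅ :=
      Finset.filter_eq_empty_iff.2 fun e _ => hL e
    simp only [h2, Finset.prod_empty]
    exact iteratedIntegral_const hdeg _ _ _ _
  simp [PseudoGraphoningData.density, h, hlam]

/-- If degree measures give small weight to the points in relation `R` to a given point, and small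
weight to the neighborhoods of points unrelated to the base point, then the density of a graph that
is not a tree is small. -/
theorem PseudoGraphoningData.density_le_of_nontree {P : PseudoGraphoningData X}
    (hlam : P.lam Set.univ ≤ 1) (hdeg : ∀ x, P.deg x Set.univ ≤ 1)
    (hW : ∀ x y, P.W x y ∈ Set.Icc (0 : ℝ) 1)
    {R : X → X → Prop} (hR : ∀ x y, R x y → R y x) {ε : ℝ≥0∞}
    (hRdeg : ∀ x z, P.deg x {y | R z y} ≤ ε)
    (hco : ∀ x z, ¬ R z x → P.deg x {y | P.W z y ≠ 0} ≤ ε)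
    {e : U × U} (he : L.IsNontree e) : P.density L ≤ 2 * ε := by
  classical
  obtain ⟨k, v⟩ := e
  obtain ⟨hadj, hkv, hkp⟩ := id he
  simp only at hadj hkv hkp
  have hv0 : 0 < (L.label v : ℕ) := (Nat.zero_le _).trans_lt hkv
  obtain ⟨l₁, l₂, hl, hl₂, hl₁, hpw⟩ := L.exists_split hv0
  have hpv := L.parent_lt v hv0
  have hmain : ∀ x₀, P.rootedDensity L x₀ ≤ 2 * ε := by
    intro x₀
    -- All factors are at most 1, so only that of the edge `(k, v)` is kept, and `W` is bounded by
    -- the indicator of its support.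
    have step1 : P.rootedDensity L x₀ ≤ iteratedIntegral P.deg L.parent
        (fun x => {y | P.W (x k) y ≠ 0}.indicator (fun _ => 1) (x v)) (l₁ ++ v :: l₂)
          (fun _ => x₀) := by
      rw [PseudoGraphoningData.rootedDensity, hl]
      refine iteratedIntegral_mono _ _ (fun x => ?_) _ _
      have hle : ∀ e : U × U, ENNReal.ofReal (P.W (x e.1) (x e.2)) ≤ 1 := fun e =>
        ENNReal.ofReal_le_one.2 (hW _ _).2
      have hmem : (k, v) ∈ Finset.univ.filter fun e : U × U =>
        F.Adj e.1 e.2 ∧ L.label e.1 < L.label e.2 ∧ e.1 ≠ L.parent e.2 := by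
        exact Finset.mem_filter.2 ⟨Finset.mem_univ _, he⟩
      rw [← Finset.mul_prod_erase _ _ hmem]
      refine (mul_le_of_le_one_right' (Finset.prod_le_one' fun e _ => hle e)).trans ?_
      by_cases h0 : P.W (x k) (x v) = 0
      · simp [h0]
      · rw [Set.indicator_of_mem (by exact h0)]
        exact hle (k, v)
    -- Integrate from `v` inwards with earlier coordinates fixed. If x_k and x_{parent v} are
    -- unrelated, `hco` gives `ε`; otherwise the indicator absorbs the total mass.
    have step2 : ∀ x, iteratedIntegral P.deg L.parent
        (fun x => {y | P.W (x k) y ≠ 0}.indicator (fun _ => 1) (x v)) (v :: l₂) x ≤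
        ε + {y | R (x k) y}.indicator (fun _ => 1) (x (L.parent v)) := by
      intro x
      have hkl : k ∉ v :: l₂ := by
        rw [List.mem_cons]
        rintro (rfl | h)
        · exact lt_irrefl _ hkv
        · exact lt_asymm hkv (hl₂ _ h)
      have hvl : v ∉ l₂ := fun h => lt_irrefl _ (hl₂ _ h)
      refine (iteratedIntegral_rel_le hdeg L.parent hvl hkl (fun a b => P.W a b ≠ 0) x).trans ?_
      by_cases hr : R (x k) (x (L.parent v))
      · rw [Set.indicator_of_mem (by exact hr)]
        refine ((measure_mono (Set.subset_univ _)).trans (hdeg _)).trans le_add_self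
      · exact (hco _ _ hr).trans le_self_add
    -- For two nodes before `v`, the later one `b` is not the root, so it is integrated while x_a is
    -- already fixed, and `hRdeg` applies.
    have aux : ∀ a b : U, L.label a < L.label b → L.label b < L.label v →
        iteratedIntegral P.deg L.parent
          (fun x => {y | R (x a) y}.indicator (fun _ => 1) (x b)) l₁ (fun _ => x₀) ≤ ε := by
      intro a b hab hbv
      have hb : b ∈ l₁ := (hl₁ b).2 ⟨(Nat.zero_le _).trans_lt hab, hbv⟩
      obtain ⟨m₁, m₂, hm⟩ := List.append_of_mem hb
      rw [hm, List.pairwise_append, List.pairwise_cons] at hpw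
      obtain ⟨-, ⟨h2, -⟩, -⟩ := hpw
      rw [hm, iteratedIntegral_append]
      refine iteratedIntegral_le_const hdeg _ _ _ fun x => ?_
      refine (iteratedIntegral_rel_le hdeg L.parent ?_ ?_ R x).trans (hRdeg _ _)
      · exact fun h => lt_irrefl _ (h2 _ h)
      · rw [List.mem_cons]
        rintro (rfl | h)
        · exact lt_irrefl _ hab
        · exact lt_asymm hab (h2 _ h)
    refine step1.trans ?_
    rw [iteratedIntegral_append]
    refine (iteratedIntegral_mono _ _ step2 _ _).trans ?_
    refine (iteratedIntegral_const_add_le hdeg _ _ _ _ _).trans ?_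
    rw [two_mul]
    gcongr
    -- Either of `k` and `parent v` may be the later one; symmetry of `R` covers the second case.
    rcases lt_or_gt_of_ne (fun h => hkp (L.label.injective h)) with h | h
    · exact aux _ _ h hpv
    · refine (iteratedIntegral_mono _ _ (fun x => ?_) _ _).trans (aux _ _ h hkv)
      by_cases hr : R (x k) (x (L.parent v))
      · rw [Set.indicator_of_mem (by exact hr), Set.indicator_of_mem (by exact hR _ _ hr)]
      · rw [Set.indicator_of_notMem (by exact hr)]
        exact zero_le
  calc P.density L ≤ ∫⁻ _, 2 * ε ∂P.lam := lintegral_mono hmain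
    _ ≤ 2 * ε := by
      rw [lintegral_const]
      exact mul_le_of_le_one_right' hlam

end Iterated

/-! ### Finite regular graphs -/

section Finite

variable {V : Type*} [Fintype V] [MeasurableSpace V] {U : Type*}

open Classical in
/-- A finite graph as a pseudo-graphoning; the degree measures are normalized by `d`. -/
noncomputable def graphData (G : SimpleGraph V) (d : ℕ) : PseudoGraphoningData V where
  lam := (Fintype.card V : ℝ≥0∞)⁻¹ • Measure.count
  W x y := if G.Adj x y then 1 else 0
  deg x := (d : ℝ≥0∞)⁻¹ • Measure.count.restrict {y | G.Adj x y}

variable [MeasurableSingletonClass V]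

open Classical in
theorem lintegral_graphData_deg (G : SimpleGraph V) (d : ℕ) (x : V) (f : V → ℝ≥0∞) :
    ∫⁻ y, f y ∂((graphData G d).deg x) =
      (d : ℝ≥0∞)⁻¹ * ∑ y, if G.Adj x y then f y else 0 := by
  rw [graphData, lintegral_smul_measure, ← lintegral_indicator (Set.toFinite _).measurableSet,
    lintegral_count, tsum_fintype, smul_eq_mul]
  simp only [Set.indicator_apply, Set.mem_ofPred_eq]

theorem graphData_deg_apply (G : SimpleGraph V) (d : ℕ) (x : V) (A : Set V) :
    (graphData G d).deg x A = (d : ℝ≥0∞)⁻¹ * ((A ∩ G.neighborSet x).ncard : ℝ≥0∞) := by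
  rw [graphData, Measure.smul_apply, Measure.restrict_apply (Set.toFinite _).measurableSet,
    Measure.count_apply (Set.toFinite _).measurableSet, smul_eq_mul]
  congr 1
  rw [← (Set.toFinite _).cast_ncard_eq, ENat.toENNReal_coe]
  rfl

-- Iterated integrals over a finite graph count the extensions of `x` to the nodes in `l` that
-- respect the tree edges, with a factor 1/d for each node.
open Classical in
theorem iteratedIntegral_graphData [Fintype U] {F : SimpleGraph U} (L : AdmissibleLabeling F)
    (G : SimpleGraph V) (d : ℕ) (f : (U → V) → ℝ≥0∞) (l : List U)
    (hl : l.Pairwise fun u v => L.label u < L.label v) (hl0 : ∀ v ∈ l, 0 < (L.label v : ℕ))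
    (x : U → V) :
    iteratedIntegral (graphData G d).deg L.parent f l x =
      (d : ℝ≥0∞)⁻¹ ^ l.length * ∑ g : U → V,
        if (∀ v, v ∉ l → g v = x v) ∧ ∀ v ∈ l, G.Adj (g (L.parent v)) (g v) then f g else 0 := by
  induction l generalizing x with
  | nil =>
    have : ∀ g : U → V, (∀ v, g v = x v) ↔ g = x := fun g => funext_iff.symm
    simp [iteratedIntegral, this]
  | cons v l ih =>
    rw [List.pairwise_cons] at hl
    have hvl : v ∉ l := fun h => lt_irrefl _ (hl.1 _ h)
    have hp := L.parent_lt v (hl0 v List.mem_cons_self)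
    have hpv : L.parent v ∉ v :: l := by
      rw [List.mem_cons]
      rintro (h | h)
      · rw [h] at hp; exact lt_irrefl _ hp
      · exact lt_asymm hp (hl.1 _ h)
    rw [iteratedIntegral, lintegral_graphData_deg, List.length_cons, pow_succ', mul_assoc]
    congr 1
    simp only [ih hl.2 (fun u hu => hl0 u (List.mem_cons_of_mem _ hu))]
    simp_rw [← mul_ite_zero]
    rw [← Finset.mul_sum]
    congr 1
    simp_rw [← Finset.sum_filter (s := Finset.univ) (p := fun y => G.Adj (x (L.parent v)) y)]
    rw [Finset.sum_comm]
    refine Finset.sum_congr rfl fun g _ => ?_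
    -- Since `v ∉ l`, the coordinate of `g` at `v` is frozen at `y` by the inner integral; only `y =
    -- g v` contributes.
    rw [Finset.sum_filter, Finset.sum_eq_single (g v)]
    · rw [← ite_and]
      refine if_congr ?_ rfl rfl
      constructor
      · rintro ⟨h1, h2, h3⟩
        have h4 : ∀ u, u ∉ v :: l → g u = x u := by
          intro u hu
          rw [List.mem_cons, not_or] at hu
          rw [h2 u hu.2, Function.update_of_ne hu.1]
        refine ⟨h4, fun u hu => ?_⟩
        rcases List.mem_cons.1 hu with rfl | hu
        · rw [h4 _ hpv]; exact h1
        · exact h3 u hu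
      · rintro ⟨h1, h2⟩
        refine ⟨?_, fun u hu => ?_, fun u hu => h2 u (List.mem_cons_of_mem _ hu)⟩
        · rw [← h1 _ hpv]; exact h2 v List.mem_cons_self
        · by_cases huv : u = v
          · rw [huv, Function.update_self]
          · rw [Function.update_of_ne huv]
            exact h1 u (by simp [huv, hu])
    · intro y _ hy
      split_ifs with h1 h2
      · exact absurd (by simpa using h2.1 v hvl) hy.symm
      · rfl
      · rfl
    · exact fun h => absurd (Finset.mem_univ _) h

/-- Tree edges are enforced by the degree measures and the remaining edges by the product of values
of `W`; together they cut out the homomorphisms. The normalization comes from 1/v(G) in `lam` and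
1/d for each nonroot node. -/
theorem density_graphData [Nonempty V] [Fintype U] {F : SimpleGraph U} (hF : F.Connected)
    (L : AdmissibleLabeling F) (G : SimpleGraph V) {d : ℕ} (hd : 0 < d) :
    (graphData G d).density L = ENNReal.ofReal (homDensity F G d) := by
  classical
  obtain ⟨o⟩ := hF.nonempty
  have hU : 0 < Fintype.card U := Fintype.card_pos_iff.mpr ⟨o⟩
  let r : U := L.label.symm ⟨0, hU⟩
  have hr : ∀ v, v ∉ L.nonrootNodes ↔ v = r := by
    intro v
    rw [L.mem_nonrootNodes, Nat.pos_iff_ne_zero, not_not]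
    simp only [r, Equiv.eq_symm_apply, Fin.ext_iff]
  have hprod : ∀ g : U → V, (∏ e : U × U with
        F.Adj e.1 e.2 ∧ L.label e.1 < L.label e.2 ∧ e.1 ≠ L.parent e.2,
      ENNReal.ofReal ((graphData G d).W (g e.1) (g e.2))) =
      if (∀ e, L.IsNontree e → G.Adj (g e.1) (g e.2)) then 1 else 0 := by
    intro g
    split_ifs with h
    · refine Finset.prod_eq_one fun e he => ?_
      simp [graphData, h e (Finset.mem_filter.1 he).2]
    · push Not at h
      obtain ⟨e, he, hg⟩ := h
      exact Finset.prod_eq_zero (Finset.mem_filter.2 ⟨Finset.mem_univ e, he⟩)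
        (by simp [graphData, hg])
  have hhom : ∀ g : U → V, ((∀ v ∈ L.nonrootNodes, G.Adj (g (L.parent v)) (g v)) ∧
      ∀ e, L.IsNontree e → G.Adj (g e.1) (g e.2)) ↔ ∀ u v, F.Adj u v → G.Adj (g u) (g v) := by
    intro g
    constructor
    · rintro ⟨h1, h2⟩
      -- Directed towards the larger label, an edge is either the parent edge of its end or a
      -- non-tree edge.
      have key : ∀ u v, L.label u < L.label v → F.Adj u v → G.Adj (g u) (g v) := by
        intro u v hlt huv
        by_cases hup : u = L.parent v
        · rw [hup]
          exact h1 v (L.mem_nonrootNodes.2 ((Nat.zero_le _).trans_lt hlt))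
        · exact h2 (u, v) ⟨huv, hlt, hup⟩
      intro u v huv
      rcases lt_or_gt_of_ne (fun h => huv.ne (L.label.injective h)) with h | h
      · exact key u v h huv
      · exact (key v u h huv.symm).symm
    · exact fun h => ⟨fun v hv => h _ _ (L.parent_adj v (L.mem_nonrootNodes.1 hv)),
        fun e he => h _ _ he.1⟩
  have hcard : (Nat.card (F →g G) : ℝ≥0∞) =
      ∑ g : U → V, if ∀ u v, F.Adj u v → G.Adj (g u) (g v) then 1 else 0 := by
    let E : (F →g G) ≃ {g : U → V // ∀ u v, F.Adj u v → G.Adj (g u) (g v)} :=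
      ⟨fun φ => ⟨φ, fun u v h => φ.map_adj h⟩, fun g => ⟨g.1, fun h => g.2 _ _ h⟩,
        fun φ => rfl, fun g => rfl⟩
    rw [Finset.sum_boole, Nat.card_congr E, Nat.card_eq_fintype_card, Fintype.card_subtype]
  have hden : (graphData G d).density L = (Fintype.card V : ℝ≥0∞)⁻¹ *
      ((d : ℝ≥0∞)⁻¹ ^ (Fintype.card U - 1) * Nat.card (F →g G)) := by
    have hroot : ∀ x₀, (graphData G d).rootedDensity L x₀ =
        (d : ℝ≥0∞)⁻¹ ^ (Fintype.card U - 1) * ∑ g : U → V,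
          if g r = x₀ then (if ∀ u v, F.Adj u v → G.Adj (g u) (g v) then 1 else 0) else 0 := by
      intro x₀
      rw [PseudoGraphoningData.rootedDensity, iteratedIntegral_graphData L G d _ _
        L.pairwise_nonrootNodes (fun v hv => L.mem_nonrootNodes.1 hv), L.length_nonrootNodes]
      congr 1
      refine Finset.sum_congr rfl fun g _ => ?_
      rw [hprod, ← ite_and, ← ite_and]
      refine if_congr ?_ rfl rfl
      rw [and_assoc, hhom]
      simp [hr]
    rw [PseudoGraphoningData.density, graphData, lintegral_smul_measure, lintegral_count,
      tsum_fintype, smul_eq_mul]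
    congr 1
    change ∑ x₀, (graphData G d).rootedDensity L x₀ = _
    simp_rw [hroot]
    rw [← Finset.mul_sum, Finset.sum_comm, hcard]
    congr 1
    refine Finset.sum_congr rfl fun g _ => ?_
    rw [Finset.sum_ite_eq]
    simp
  have hcomp : Nat.card F.ConnectedComponent = 1 := by
    have := hF.preconnected.subsingleton_connectedComponent
    have : Nonempty F.ConnectedComponent := ⟨F.connectedComponentMk o⟩
    exact Nat.card_unique
  have hV : 0 < Fintype.card V := Fintype.card_pos
  rw [hden, homDensity, hcomp, pow_one, Nat.card_eq_fintype_card (α := V),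
    Nat.card_eq_fintype_card (α := U), ENNReal.ofReal_div_of_pos (by positivity),
    ENNReal.ofReal_mul (by positivity), ENNReal.ofReal_pow (by positivity),
    ENNReal.ofReal_natCast, ENNReal.ofReal_natCast, ENNReal.ofReal_natCast, ENNReal.div_eq_inv_mul,
    ENNReal.mul_inv (Or.inr (by finiteness)) (Or.inl (by finiteness)), ENNReal.inv_pow, mul_assoc]

end Finite

/-- `G` is a finite `d`-regular graph in which distinct nodes have at most two common neighbors. -/
structure IsSparseRegular {V : Type*} (G : SimpleGraph V) (d : ℕ) : Prop where
  finite : Finite V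
  nonempty : Nonempty V
  pos : 0 < d
  degree_eq : ∀ v, (G.neighborSet v).ncard = d
  codegree_le : ∀ u v, u ≠ v → (G.neighborSet u ∩ G.neighborSet v).ncard ≤ 2

theorem IsSparseRegular.isAdmissible {V : Type*} {G : SimpleGraph V} {d : ℕ}
    (h : IsSparseRegular G d) : IsAdmissible G d where
  finite := h.finite
  nonempty := h.nonempty
  one_le := by exact_mod_cast h.pos
  degree_le v := by rw [h.degree_eq v]

/-! ### Densities in sparse regular graphs -/

section

variable {V : Type*} {G : SimpleGraph V} {d : ℕ} {U : Type*} [Fintype U] {F : SimpleGraph U}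
  (L : AdmissibleLabeling F)

theorem IsSparseRegular.homDensity_tree (h : IsSparseRegular G d) (hF : F.Connected)
    (hL : ∀ e, ¬ L.IsNontree e) : homDensity F G d = 1 := by
  have := h.finite
  have := h.nonempty
  have := Fintype.ofFinite V
  let _ : MeasurableSpace V := ⊤
  have h1 := density_graphData hF L G h.pos
  have hd : (d : ℝ≥0∞) ≠ 0 := by exact_mod_cast h.pos.ne'
  rw [PseudoGraphoningData.density_eq_one_of_tree L ?_ ?_ hL] at h1
  · exact (ENNReal.ofReal_eq_one.1 h1.symm)
  · rw [graphData, Measure.smul_apply, Measure.count_univ, ENat.card_eq_coe_fintype_card, smul_eq_mul]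
    exact ENNReal.inv_mul_cancel (by simp) (by simp)
  · intro x
    rw [graphData_deg_apply, Set.univ_inter, h.degree_eq]
    exact ENNReal.inv_mul_cancel hd (by simp)

/-- The general bound with equality as the relation: a point has degree measure at most 1/d, and the
neighborhood of a different node at most 2/d. -/
theorem IsSparseRegular.homDensity_nontree (h : IsSparseRegular G d) (hF : F.Connected)
    {e : U × U} (he : L.IsNontree e) : ENNReal.ofReal (homDensity F G d) ≤ 2 * (2 / d) := by
  classical
  have := h.finite
  have := h.nonempty
  have := Fintype.ofFinite V
  let _ : MeasurableSpace V := ⊤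
  have hd : (d : ℝ≥0∞) ≠ 0 := by exact_mod_cast h.pos.ne'
  rw [← density_graphData hF L G h.pos]
  refine PseudoGraphoningData.density_le_of_nontree L ?_ ?_ ?_ (R := fun x y => x = y)
    (fun x y => Eq.symm) ?_ ?_ he
  · rw [graphData, Measure.smul_apply, Measure.count_univ, ENat.card_eq_coe_fintype_card, smul_eq_mul]
    exact (ENNReal.inv_mul_cancel (by simp) (by simp)).le
  · intro x
    rw [graphData_deg_apply, Set.univ_inter, h.degree_eq]
    exact (ENNReal.inv_mul_cancel hd (by simp)).le
  · intro x y
    simp only [graphData]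
    split_ifs <;> simp
  · intro x z
    rw [graphData_deg_apply, ENNReal.div_eq_inv_mul]
    gcongr
    have : ({y | z = y} ∩ G.neighborSet x).ncard ≤ ({z} : Set V).ncard :=
      Set.ncard_le_ncard (by rintro y ⟨rfl, -⟩; rfl)
    rw [Set.ncard_singleton] at this
    exact_mod_cast this.trans one_le_two
  · intro x z hxz
    rw [graphData_deg_apply, ENNReal.div_eq_inv_mul]
    gcongr
    have h2 : ({y | (graphData G d).W z y ≠ 0} ∩ G.neighborSet x) ⊆
        G.neighborSet z ∩ G.neighborSet x := by
      rintro y ⟨hy, hy'⟩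
      refine ⟨?_, hy'⟩
      by_contra hn
      rw [SimpleGraph.mem_neighborSet] at hn
      simp [graphData, hn] at hy
    exact_mod_cast (Set.ncard_le_ncard h2).trans (h.codegree_le z x hxz)

end

/-! ### Multiplicativity of homomorphism densities -/

/-- A homomorphism is given by its restrictions to the connected components. -/
def homEquivPi {U V : Type*} (F : SimpleGraph U) (G : SimpleGraph V) :
    (F →g G) ≃ ∀ c : F.ConnectedComponent, c.toSimpleGraph →g G where
  toFun φ c := φ.comp c.toSimpleGraph_hom
  invFun ψ :=
    { toFun u := ψ (F.connectedComponentMk u) ⟨u, rfl⟩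
      map_rel' := by
        intro u v huv
        have h : F.connectedComponentMk v = F.connectedComponentMk u :=
          SimpleGraph.ConnectedComponent.connectedComponentMk_eq_of_adj huv.symm
        -- The components of `u` and `v` are equal only propositionally, so `ψ` has to be
        -- transported along the equality.
        have h2 : ∀ (c : F.ConnectedComponent) (hc : F.connectedComponentMk v = c),
            ψ (F.connectedComponentMk v) ⟨v, rfl⟩ = ψ c ⟨v, hc⟩ := by
          rintro c rfl; rfl
        rw [h2 _ h]
        exact (ψ (F.connectedComponentMk u)).map_adj huv }
  left_inv φ := rfl
  right_inv ψ := by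
    funext c
    ext ⟨u, hu⟩
    have h2 : ∀ (c : F.ConnectedComponent) (hc : F.connectedComponentMk u = c),
        ψ (F.connectedComponentMk u) ⟨u, rfl⟩ = ψ c ⟨u, hc⟩ := by
      rintro c rfl; rfl
    exact h2 c hu

/-- Homomorphism numbers multiply over components, and v(F) - c(F) is the sum of v(C) - 1 over the
components C; components are nonempty, so the truncated subtraction is exact. -/
theorem homDensity_eq_prod {U V : Type*} [Finite U] (F : SimpleGraph U) (G : SimpleGraph V)
    [Finite V] (d : ℝ) [Fintype F.ConnectedComponent] :
    homDensity F G d = ∏ c : F.ConnectedComponent, homDensity c.toSimpleGraph G d := by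
  have hc1 : ∀ c : F.ConnectedComponent, Nat.card c.toSimpleGraph.ConnectedComponent = 1 := by
    intro c
    have hc := c.connected_toSimpleGraph
    have := hc.preconnected.subsingleton_connectedComponent
    obtain ⟨o⟩ := hc.nonempty
    have : Nonempty c.toSimpleGraph.ConnectedComponent :=
      ⟨c.toSimpleGraph.connectedComponentMk o⟩
    exact Nat.card_unique
  have hcard : Nat.card U = ∑ c : F.ConnectedComponent, Nat.card c := by
    rw [← Nat.card_sigma]
    exact Nat.card_congr (Equiv.sigmaFiberEquiv F.connectedComponentMk).symm
  have hpos : ∀ c : F.ConnectedComponent, 1 ≤ Nat.card c := by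
    intro c
    have := c.connected_toSimpleGraph.nonempty
    exact Nat.card_pos
  simp only [homDensity, hc1, pow_one]
  rw [Finset.prod_div_distrib, Finset.prod_mul_distrib, Finset.prod_const, Finset.prod_pow_eq_pow_sum,
    Nat.card_congr (homEquivPi F G), Nat.card_pi, Nat.cast_prod, Finset.card_univ,
    Nat.card_eq_fintype_card (α := F.ConnectedComponent)]
  congr 3
  rw [hcard, Finset.sum_tsub_distrib _ fun c _ => hpos c]
  simp

/-! ### Limits of sparse regular graphs -/

/-- Regular graphs in which distinct nodes have at most two common neighbors converge, as their
degrees tend to infinity, to every pseudo-graphoning in which all degrees are `1` and almost all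
pairs of points have common neighborhoods of measure zero. -/
theorem isLimit_of_isSparseRegular {V : ℕ → Type*} {G : ∀ n, SimpleGraph (V n)} {d : ℕ → ℕ}
    (hG : ∀ n, IsSparseRegular (G n) (d n)) (hd : Tendsto d atTop atTop)
    {X : Type*} [MeasurableSpace X] {P : PseudoGraphoningData X} (hP : P.IsPseudoGraphoning)
    (hdeg : ∀ x, P.deg x Set.univ = 1) {R : X → X → Prop} (hR : ∀ x y, R x y → R y x)
    (hRdeg : ∀ x z, P.deg x {y | R z y} = 0)
    (hco : ∀ x z, ¬ R z x → P.deg x {y | P.W z y ≠ 0} = 0) :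
    IsLimit G (fun n => (d n : ℝ)) P := by
  have := hP.prob
  have hlim : ∀ (U : Type) [Fintype U] (F : SimpleGraph U) (hF : F.Connected)
      (L : AdmissibleLabeling F),
      Tendsto (fun n => ENNReal.ofReal (homDensity F (G n) (d n))) atTop (𝓝 (P.density L)) := by
    intro U _ F hF L
    by_cases hL : ∃ e, L.IsNontree e
    · obtain ⟨e, he⟩ := hL
      have h0 : P.density L = 0 := by
        have h := PseudoGraphoningData.density_le_of_nontree L (P := P) (by simp)
          (fun x => (hdeg x).le) hP.W_mem hR (ε := 0) (fun x z => (hRdeg x z).le)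
          (fun x z hxz => (hco x z hxz).le) he
        simpa using h
      rw [h0]
      -- The finite densities lie between 0 and 4/d.
      refine tendsto_of_tendsto_of_tendsto_of_le_of_le tendsto_const_nhds ?_ (fun _ => zero_le)
        (fun n => (hG n).homDensity_nontree L hF he)
      have h2 : Tendsto (fun n => ((d n : ℕ) : ℝ≥0∞)⁻¹) atTop (𝓝 0) :=
        ENNReal.tendsto_inv_nat_nhds_zero.comp hd
      have h3 := ENNReal.Tendsto.const_mul (a := 2) (ENNReal.Tendsto.const_mul (a := 2) h2
        (Or.inr (by simp))) (Or.inr (by simp))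
      simpa [div_eq_mul_inv] using h3
    · push Not at hL
      rw [PseudoGraphoningData.density_eq_one_of_tree L (by simp) hdeg hL]
      simp [(hG _).homDensity_tree L hF hL]
  refine ⟨⟨fun n => (hG n).isAdmissible, fun U _ F => ?_⟩, hP, fun U _ F hF L => hlim U F hF L⟩
  have := Fintype.ofFinite F.ConnectedComponent
  have hn : ∀ n, homDensity F (G n) (d n) =
      ∏ c : F.ConnectedComponent, homDensity c.toSimpleGraph (G n) (d n) := by
    intro n
    have := (hG n).finite
    exact homDensity_eq_prod F (G n) (d n)
  simp_rw [hn]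
  have hc : ∀ c : F.ConnectedComponent, ∃ l : ℝ,
      Tendsto (fun n => homDensity c.toSimpleGraph (G n) (d n)) atTop (𝓝 l) := by
    intro c
    have := Fintype.ofFinite c
    have hcon := c.connected_toSimpleGraph
    obtain ⟨L⟩ := AdmissibleLabeling.nonempty hcon
    have h1 := hlim _ c.toSimpleGraph hcon L
    -- Finiteness allows the limit in `ℝ≥0∞` to be read as a real limit.
    have h2 : P.density L ≠ ∞ := by
      by_cases hL : ∃ e, L.IsNontree e
      · obtain ⟨e, he⟩ := hL
        have h := PseudoGraphoningData.density_le_of_nontree L (P := P) (by simp)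
          (fun x => (hdeg x).le) hP.W_mem hR (ε := 0) (fun x z => (hRdeg x z).le)
          (fun x z hxz => (hco x z hxz).le) he
        exact ne_top_of_le_ne_top (by simp) h
      · push Not at hL
        rw [PseudoGraphoningData.density_eq_one_of_tree L (by simp) hdeg hL]
        simp
    refine ⟨(P.density L).toReal, ((ENNReal.tendsto_toReal h2).comp h1).congr fun n => ?_⟩
    refine ENNReal.toReal_ofReal ?_
    rw [homDensity]
    positivity
  choose l hl using hc
  exact ⟨_, tendsto_finsetProd _ fun c _ => hl c⟩

/-! ### Hypercubes and incidence graphs of projective planes -/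

theorem hypercube_adj_iff {d : ℕ} {x y : Fin d → Fin 2} :
    (hypercube d).Adj x y ↔ ∃ i, y = Function.update x i (x i + 1) := by
  have h2 : ∀ a b : Fin 2, a ≠ b → b = a + 1 := by decide
  change hammingDist x y = 1 ↔ _
  rw [hammingDist, Finset.card_eq_one]
  refine exists_congr fun i => ?_
  constructor
  · intro h
    funext j
    have hj := congrArg (j ∈ ·) h
    simp only [Finset.mem_filter, Finset.mem_univ, true_and, Finset.mem_singleton, eq_iff_iff] at hj
    by_cases hji : j = i
    · subst hji
      rw [Function.update_self]
      exact h2 _ _ (hj.2 rfl)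
    · rw [Function.update_of_ne hji]
      by_contra hne
      exact hji (hj.1 (Ne.symm hne))
  · rintro rfl
    ext j
    simp only [Finset.mem_filter, Finset.mem_univ, true_and, Finset.mem_singleton]
    by_cases hji : j = i
    · subst hji
      simp
    · simp [hji]

theorem isSparseRegular_hypercube {d : ℕ} (hd : 0 < d) : IsSparseRegular (hypercube d) d where
  finite := inferInstance
  nonempty := inferInstance
  pos := hd
  degree_eq x := by
    have h : (hypercube d).neighborSet x = Set.range fun i => Function.update x i (x i + 1) := by
      ext y
      rw [SimpleGraph.mem_neighborSet, hypercube_adj_iff]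
      simp [eq_comm]
    have hinj : Function.Injective fun i => Function.update x i (x i + 1) := by
      intro i j hij
      by_contra hne
      have := congrFun hij i
      simp [hne] at this
    rw [h, ← Set.image_univ, Set.ncard_image_of_injective _ hinj, Set.ncard_univ, Nat.card_fin]
  codegree_le x z hxz := by
    -- At a coordinate `j` where `x` and `z` differ, a common neighbor differs from one of them. The
    -- single flip leading to it from that node is therefore at `j`, which leaves two candidates.
    obtain ⟨j, hj⟩ := Function.ne_iff.1 hxz
    have h : (hypercube d).neighborSet x ∩ (hypercube d).neighborSet z ⊆
        {Function.update x j (x j + 1), Function.update z j (z j + 1)} := by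
      rintro y ⟨hx, hz⟩
      obtain ⟨i, rfl⟩ := hypercube_adj_iff.1 hx
      obtain ⟨i', hi'⟩ := hypercube_adj_iff.1 hz
      by_cases hij : i = j
      · exact Or.inl (by rw [hij])
      · by_cases hij' : i' = j
        · exact Or.inr (by rw [hi', hij']; rfl)
        · have := congrFun hi' j
          rw [Function.update_of_ne (Ne.symm hij), Function.update_of_ne (Ne.symm hij')] at this
          exact absurd this hj
    refine (Set.ncard_le_ncard h).trans ((Set.ncard_insert_le _ _).trans ?_)
    rw [Set.ncard_singleton]

theorem card_hypercube (d : ℕ) : Nat.card (Fin d → Fin 2) = 2 ^ d := by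
  simp

section Plane

variable {P L : Type*} [Membership P L]

theorem incidenceGraph_neighborSet_inl (p : P) :
    (incidenceGraph P L).neighborSet (Sum.inl p) = Sum.inr '' {l | p ∈ l} := by
  ext (p' | l) <;> simp [incidenceGraph]

theorem incidenceGraph_neighborSet_inr (l : L) :
    (incidenceGraph P L).neighborSet (Sum.inr l) = Sum.inl '' {p | p ∈ l} := by
  ext (p | l') <;> simp [incidenceGraph]

variable [Finite P] [Finite L] [Configuration.ProjectivePlane P L]

theorem isSparseRegular_incidenceGraph :
    IsSparseRegular (incidenceGraph P L) (Configuration.ProjectivePlane.order P L + 1) where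
  finite := inferInstance
  nonempty := by
    obtain ⟨p, -⟩ := Configuration.ProjectivePlane.exists_config (P := P) (L := L)
    exact ⟨Sum.inl p⟩
  pos := Nat.succ_pos _
  degree_eq v := by
    rcases v with p | l
    · rw [incidenceGraph_neighborSet_inl, Set.ncard_image_of_injective _ Sum.inr_injective]
      exact Configuration.ProjectivePlane.lineCount_eq (P := P) (L := L) p
    · rw [incidenceGraph_neighborSet_inr, Set.ncard_image_of_injective _ Sum.inl_injective]
      exact Configuration.ProjectivePlane.pointCount_eq (P := P) (L := L) l
  codegree_le u v huv := by
    -- Even at most one common neighbor: two points lie on at most one line and two lines meet in at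
    -- most one point, while a point and a line have neighbors of different kinds.
    refine le_trans ?_ one_le_two
    rw [Set.ncard_le_one_iff]
    intro a b ha hb
    rcases u with p | l <;> rcases v with p' | l' <;>
      simp only [incidenceGraph_neighborSet_inl, incidenceGraph_neighborSet_inr] at ha hb
    · obtain ⟨⟨l, hl, rfl⟩, ⟨_, hl', h⟩⟩ := ha
      obtain ⟨⟨m, hm, rfl⟩, ⟨_, hm', h'⟩⟩ := hb
      obtain rfl := Sum.inr_injective h
      obtain rfl := Sum.inr_injective h'
      rcases Configuration.Nondegenerate.eq_or_eq (P := P) (L := L) hl hl' hm hm' with h | h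
      · exact absurd (congrArg _ h) huv
      · exact congrArg _ h
    · obtain ⟨⟨l, hl, rfl⟩, ⟨_, hl', h⟩⟩ := ha
      simp at h
    · obtain ⟨⟨l, hl, rfl⟩, ⟨_, hl', h⟩⟩ := ha
      simp at h
    · obtain ⟨⟨l, hl, rfl⟩, ⟨_, hl', h⟩⟩ := ha
      obtain ⟨⟨m, hm, rfl⟩, ⟨_, hm', h'⟩⟩ := hb
      obtain rfl := Sum.inl_injective h
      obtain rfl := Sum.inl_injective h'
      rcases Configuration.Nondegenerate.eq_or_eq (P := P) (L := L) hl hm hl' hm' with h | h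
      · exact congrArg _ h
      · exact absurd (congrArg _ h) huv

variable (P L) in
theorem card_incidenceGraph : Nat.card (P ⊕ L) = 2 * (Configuration.ProjectivePlane.order P L ^ 2 +
    Configuration.ProjectivePlane.order P L + 1) := by
  have := Fintype.ofFinite P
  have := Fintype.ofFinite L
  rw [Nat.card_sum, Nat.card_eq_fintype_card, Nat.card_eq_fintype_card,
    Configuration.ProjectivePlane.card_points P L, Configuration.ProjectivePlane.card_lines P L,
    two_mul]

end Plane

/-! ### Series with gaps -/

/-- The sum `∑_{j ≥ k} b_j (e_j - e_{j+1})`. -/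
noncomputable def gapTail (e b : ℕ → ℝ) (k : ℕ) : ℝ :=
  ∑' j, b (j + k) * (e (j + k) - e (j + k + 1))

/-- All terms of the sequence are `0` or `1`. -/
def IsBit (b : ℕ → ℝ) : Prop := ∀ k, b k = 0 ∨ b k = 1

theorem IsBit.nonneg {b : ℕ → ℝ} (hb : IsBit b) (k : ℕ) : 0 ≤ b k := by
  rcases hb k with h | h <;> simp [h]

theorem IsBit.abs_le {b : ℕ → ℝ} (hb : IsBit b) (k : ℕ) : |b k| ≤ 1 := by
  rcases hb k with h | h <;> simp [h]

theorem IsBit.compl {b : ℕ → ℝ} (hb : IsBit b) : IsBit (1 - b) := fun k => by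
  rcases hb k with h | h <;> simp [h]

section Gap

variable {e : ℕ → ℝ} (he : Antitone e) (he0 : Tendsto e atTop (𝓝 0)) {b c : ℕ → ℝ} {B C : ℝ}

include he he0

/-- The series telescopes. -/
theorem hasSum_gap (k : ℕ) : HasSum (fun j => e (j + k) - e (j + k + 1)) (e k) := by
  rw [hasSum_iff_tendsto_nat_of_nonneg (fun _ => sub_nonneg.2 (he (Nat.le_succ _)))]
  have h1 : ∀ n, ∑ j ∈ Finset.range n, (e (j + k) - e (j + k + 1)) = e k - e (n + k) := by
    intro n
    have := Finset.sum_range_sub' (fun j => e (j + k)) n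
    simp only [zero_add] at this
    rw [← this]
    exact Finset.sum_congr rfl fun j _ => by rw [Nat.add_right_comm]
  simp_rw [h1]
  simpa using tendsto_const_nhds.sub ((tendsto_add_atTop_iff_nat k).2 he0)

theorem summable_gap (hb : ∀ k, |b k| ≤ B) (k : ℕ) :
    Summable fun j => b (j + k) * (e (j + k) - e (j + k + 1)) := by
  refine Summable.of_norm_bounded ((hasSum_gap he he0 k).summable.mul_left B) fun j => ?_
  rw [norm_mul, Real.norm_eq_abs, Real.norm_eq_abs,
    abs_of_nonneg (sub_nonneg.2 (he (Nat.le_succ (j + k))))]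
  exact mul_le_mul_of_nonneg_right (hb _) (sub_nonneg.2 (he (Nat.le_succ (j + k))))

theorem gapTail_eq_add (hb : ∀ k, |b k| ≤ B) (k : ℕ) :
    gapTail e b k = b k * (e k - e (k + 1)) + gapTail e b (k + 1) := by
  rw [gapTail, (summable_gap he he0 hb k).tsum_eq_zero_add, zero_add]
  congr 1
  refine tsum_congr fun j => ?_
  rw [Nat.add_right_comm j 1 k, Nat.add_assoc j k 1]

theorem gapTail_sub (hb : ∀ k, |b k| ≤ B) (hc : ∀ k, |c k| ≤ C) (k : ℕ) :
    gapTail e (b - c) k = gapTail e b k - gapTail e c k := by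
  rw [gapTail, gapTail, gapTail,
    ← (summable_gap he he0 hb k).tsum_sub (summable_gap he he0 hc k)]
  exact tsum_congr fun j => sub_mul _ _ _

theorem gapTail_one (k : ℕ) : gapTail e 1 k = e k := by
  rw [gapTail, ← (hasSum_gap he he0 k).tsum_eq]
  simp

theorem gapTail_compl (hb : ∀ k, |b k| ≤ B) (k : ℕ) :
    gapTail e (1 - b) k = e k - gapTail e b k := by
  rw [gapTail_sub he he0 (B := 1) (by simp) hb, gapTail_one he he0]

omit he0 in
theorem gapTail_nonneg (hb : ∀ k, 0 ≤ b k) (k : ℕ) : 0 ≤ gapTail e b k :=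
  tsum_nonneg fun _ => mul_nonneg (hb _) (sub_nonneg.2 (he (Nat.le_succ _)))

theorem abs_gapTail_le (hb : ∀ k, |b k| ≤ B) (k : ℕ) : |gapTail e b k| ≤ B * e k := by
  rw [← Real.norm_eq_abs]
  refine tsum_of_norm_bounded ((hasSum_gap he he0 k).mul_left B) fun j => ?_
  rw [norm_mul, Real.norm_eq_abs, Real.norm_eq_abs,
    abs_of_nonneg (sub_nonneg.2 (he (Nat.le_succ (j + k))))]
  exact mul_le_mul_of_nonneg_right (hb _) (sub_nonneg.2 (he (Nat.le_succ (j + k))))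

theorem IsBit.gapTail_le (hb : IsBit b) (k : ℕ) : gapTail e b k ≤ e k := by
  simpa using (le_abs_self _).trans (abs_gapTail_le he he0 hb.abs_le k)

theorem gapTail_eq_of_zero (hb : ∀ k, |b k| ≤ B) {k n : ℕ} (hkn : k ≤ n)
    (h : ∀ i, k ≤ i → i < n → b i = 0) : gapTail e b k = gapTail e b n := by
  induction n, hkn using Nat.le_induction with
  | base => rfl
  | succ n hkn ih =>
    rw [ih fun i hi hin => h i hi (hin.trans n.lt_succ_self), gapTail_eq_add he he0 hb,
      h n hkn n.lt_succ_self, zero_mul, zero_add]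

theorem gapTail_sub_eq (hb : ∀ k, |b k| ≤ B) (hc : ∀ k, |c k| ≤ C) {k : ℕ}
    (h : ∀ i < k, b i = c i) :
    gapTail e b 0 - gapTail e c 0 = gapTail e b k - gapTail e c k := by
  rw [← gapTail_sub he he0 hb hc, ← gapTail_sub he he0 hb hc]
  refine gapTail_eq_of_zero he he0 (B := B + C) (fun j => ?_) (Nat.zero_le k) fun i _ hi => ?_
  · exact (abs_sub _ _).trans (add_le_add (hb j) (hc j))
  · simp [h i hi]

/-- If the gaps are large, then a vanishing sum has vanishing coefficients. -/
theorem eq_zero_of_gapTail_eq_zero (hgap : ∀ k, B * e (k + 1) < e k - e (k + 1))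
    (hb : ∀ k, |b k| ≤ B) (hb1 : ∀ k, b k = 0 ∨ 1 ≤ |b k|) (h : gapTail e b 0 = 0) (k : ℕ) :
    b k = 0 := by
  classical
  by_contra hk
  have hex : ∃ k, b k ≠ 0 := ⟨k, hk⟩
  -- The first nonzero term is at least the gap at `n` in absolute value, whereas the tail after it
  -- is at most `B * e (n + 1)`; they cannot cancel.
  set n := Nat.find hex
  have hn : b n ≠ 0 := Nat.find_spec hex
  have hlt : ∀ i < n, b i = 0 := fun i hi => not_not.1 (Nat.find_min hex hi)
  rw [gapTail_eq_of_zero he he0 hb (Nat.zero_le n) fun i _ hi => hlt i hi,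
    gapTail_eq_add he he0 hb] at h
  have h1 := abs_gapTail_le he he0 hb (n + 1)
  have h2 := (hb1 n).resolve_left hn
  have h3 : |b n * (e n - e (n + 1))| = |gapTail e b (n + 1)| := by
    rw [eq_neg_of_add_eq_zero_left h, abs_neg]
  have h4 : 0 ≤ e n - e (n + 1) := sub_nonneg.2 (he n.le_succ)
  rw [abs_mul, abs_of_nonneg h4] at h3
  have h5 := mul_le_mul_of_nonneg_right h2 h4
  have h6 := hgap n
  linarith

end Gap

/-! ### Binary digits -/

theorem antitone_half_pow : Antitone fun k : ℕ => (1 / 2 : ℝ) ^ k :=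
  fun _ _ h => pow_le_pow_of_le_one (by norm_num) (by norm_num) h

theorem tendsto_half_pow : Tendsto (fun k : ℕ => (1 / 2 : ℝ) ^ k) atTop (𝓝 0) :=
  tendsto_pow_atTop_nhds_zero_of_lt_one (by norm_num) (by norm_num)

/-- The binary digit of `x` with weight `2^{-(k+1)}`. -/
noncomputable def binDigit (x : ℝ) (k : ℕ) : ℝ :=
  ((⌊2 ^ (k + 1) * x⌋ - 2 * ⌊2 ^ k * x⌋ : ℤ) : ℝ)

theorem floor_two_mul_eq (y : ℝ) : ⌊2 * y⌋ = 2 * ⌊y⌋ ∨ ⌊2 * y⌋ = 2 * ⌊y⌋ + 1 := by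
  have h1 : 2 * ⌊y⌋ ≤ ⌊2 * y⌋ := by
    rw [Int.le_floor]; push_cast; linarith [Int.floor_le y]
  have h2 : ⌊2 * y⌋ < 2 * ⌊y⌋ + 2 := by
    rw [Int.floor_lt]; push_cast; linarith [Int.lt_floor_add_one y]
  omega

theorem isBit_binDigit (x : ℝ) : IsBit (binDigit x) := by
  intro k
  rw [binDigit, pow_succ', mul_assoc]
  rcases floor_two_mul_eq (2 ^ k * x) with h | h <;> rw [h] <;> simp

theorem measurable_binDigit (k : ℕ) : Measurable fun x => binDigit x k := by
  unfold binDigit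
  fun_prop

theorem hasSum_binDigit {x : ℝ} (hx : x ∈ Set.Ico (0 : ℝ) 1) :
    gapTail (fun k => (1 / 2 : ℝ) ^ k) (binDigit x) 0 = x := by
  have h1 := (summable_gap antitone_half_pow tendsto_half_pow (isBit_binDigit x).abs_le 0).hasSum
  refine tendsto_nhds_unique h1.tendsto_sum_nat ?_
  -- The partial sums telescope to the dyadic truncations of `x`; the start uses ⌊x⌋ = 0.
  have h2 : ∀ n, ∑ k ∈ Finset.range n, binDigit x (k + 0) *
      ((1 / 2 : ℝ) ^ (k + 0) - (1 / 2) ^ (k + 0 + 1)) = ⌊2 ^ n * x⌋ * (1 / 2 : ℝ) ^ n := by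
    intro n
    induction n with
    | zero => simp [Int.floor_eq_zero_iff.2 hx]
    | succ n ih =>
      rw [Finset.sum_range_succ, ih, binDigit, add_zero, pow_succ (1 / 2 : ℝ)]
      generalize ⌊2 ^ (n + 1) * x⌋ = i
      generalize ⌊2 ^ n * x⌋ = j
      push_cast
      ring
  simp_rw [h2]
  have h3 : ∀ n : ℕ, (2 : ℝ) ^ n * x * (1 / 2) ^ n = x := fun n => by
    rw [mul_right_comm, ← mul_pow]; norm_num
  have h4 : ∀ n : ℕ, (0 : ℝ) < (1 / 2) ^ n := fun n => by positivity
  refine tendsto_of_tendsto_of_tendsto_of_le_of_le (g := fun n => x - (1 / 2) ^ n) (h := fun _ => x)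
    ?_ tendsto_const_nhds (fun n => ?_) fun n => ?_
  · simpa using tendsto_const_nhds.sub tendsto_half_pow
  · have := mul_le_mul_of_nonneg_right (Int.lt_floor_add_one ((2 : ℝ) ^ n * x)).le (h4 n).le
    rw [h3, add_mul, one_mul] at this
    linarith
  · have := mul_le_mul_of_nonneg_right (Int.floor_le ((2 : ℝ) ^ n * x)) (h4 n).le
    rwa [h3] at this

theorem floor_eq_of_binDigit_eq {x y : ℝ} (hx : x ∈ Set.Ico (0 : ℝ) 1) (hy : y ∈ Set.Ico (0 : ℝ) 1)
    {n : ℕ} (h : ∀ k < n, binDigit x k = binDigit y k) : ⌊2 ^ n * x⌋ = ⌊2 ^ n * y⌋ := by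
  induction n with
  | zero => simp [Int.floor_eq_zero_iff.2 hx, Int.floor_eq_zero_iff.2 hy]
  | succ n ih =>
    have h1 := ih fun k hk => h k (hk.trans n.lt_succ_self)
    have h2 := h n n.lt_succ_self
    simp only [binDigit, Int.cast_inj] at h2
    omega

/-- Digits determine the number, so some digit differs. Before the first such place the floors
agree, and monotonicity of the floor orders the differing digits. -/
theorem exists_first_binDigit {x y : ℝ} (hx : x ∈ Set.Ico (0 : ℝ) 1) (hy : y ∈ Set.Ico (0 : ℝ) 1)
    (hxy : x < y) :
    ∃ k, (∀ i < k, binDigit x i = binDigit y i) ∧ binDigit x k = 0 ∧ binDigit y k = 1 := by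
  classical
  have hex : ∃ k, binDigit x k ≠ binDigit y k := by
    by_contra! hcon
    have := hasSum_binDigit hx
    rw [funext hcon, hasSum_binDigit hy] at this
    exact hxy.ne' this
  have hlt : ∀ i < Nat.find hex, binDigit x i = binDigit y i :=
    fun i hi => not_not.1 (Nat.find_min hex hi)
  refine ⟨Nat.find hex, hlt, ?_⟩
  have hne := Nat.find_spec hex
  have h1 := floor_eq_of_binDigit_eq hx hy hlt
  generalize Nat.find hex = k at *
  have h2 : binDigit x k ≤ binDigit y k := by
    rw [binDigit, binDigit, Int.cast_le, h1]
    gcongr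
  rcases isBit_binDigit x k with hx | hx <;> rcases isBit_binDigit y k with hy | hy
  · exact absurd (hx.trans hy.symm) hne
  · exact ⟨hx, hy⟩
  · rw [hx, hy] at h2; norm_num at h2
  · exact absurd (hx.trans hy.symm) hne

theorem volume_floor_eq (n : ℕ) (a : ℤ) :
    volume {x : ℝ | ⌊2 ^ n * x⌋ = a} = ENNReal.ofReal ((1 / 2) ^ n) := by
  have h5 : (0 : ℝ) < 2 ^ n := by positivity
  have h : {x : ℝ | ⌊2 ^ n * x⌋ = a} = Set.Ico ((a : ℝ) / 2 ^ n) (((a : ℝ) + 1) / 2 ^ n) := by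
    ext x
    rw [Set.mem_ofPred_eq, Int.floor_eq_iff, Set.mem_Ico, div_le_iff₀ h5, lt_div_iff₀ h5,
      mul_comm x]
  rw [h, Real.volume_Ico, ← sub_div, add_sub_cancel_left, one_div_pow]

/-- Prescribing infinitely many binary digits leaves a null set. -/
theorem volume_binDigit_eq {K : Set ℕ} (hK : K.Infinite) (c : ℕ → ℝ) :
    volume {x ∈ Set.Ico (0 : ℝ) 1 | ∀ k ∈ K, binDigit x k = c k} = 0 := by
  set E := {x ∈ Set.Ico (0 : ℝ) 1 | ∀ k ∈ K, binDigit x k = c k} with hE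
  -- On a dyadic interval of level `n`, the next `j` prescribed digits each halve the measure.
  have key : ∀ j n : ℕ, ∀ a : ℤ,
      volume (E ∩ {x | ⌊2 ^ n * x⌋ = a}) ≤ ENNReal.ofReal ((1 / 2) ^ (n + j)) := by
    intro j
    induction j with
    | zero => exact fun n a => (measure_mono Set.inter_subset_right).trans (volume_floor_eq n a).le
    | succ j ih =>
      -- Inner induction on the distance `i` to a prescribed place. At distance 0 all points of `E`
      -- in the interval lie in the same half; otherwise both halves are treated separately and the
      -- bounds add up.
      have haux : ∀ i n : ℕ, ∀ a : ℤ, n + i ∈ K →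
          volume (E ∩ {x | ⌊2 ^ n * x⌋ = a}) ≤ ENNReal.ofReal ((1 / 2) ^ (n + (j + 1))) := by
        intro i
        induction i with
        | zero =>
          intro n a hn
          by_cases hne : (E ∩ {x | ⌊2 ^ n * x⌋ = a}).Nonempty
          · obtain ⟨x₀, hx₀, hx₀'⟩ := hne
            rw [show n + (j + 1) = n + 1 + j by ring]
            refine (measure_mono ?_).trans (ih (n + 1) ⌊2 ^ (n + 1) * x₀⌋)
            rintro x ⟨hx, hx'⟩
            refine ⟨hx, ?_⟩
            have h := (hx.2 n hn).trans (hx₀.2 n hn).symm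
            simp only [binDigit, Int.cast_inj] at h
            simp only [Set.mem_ofPred_eq] at hx' hx₀' ⊢
            omega
          · rw [Set.not_nonempty_iff_eq_empty.1 hne]; simp
        | succ i ihi =>
          intro n a hn
          have hsub : E ∩ {x | ⌊2 ^ n * x⌋ = a} ⊆ (E ∩ {x | ⌊2 ^ (n + 1) * x⌋ = 2 * a}) ∪
              (E ∩ {x | ⌊2 ^ (n + 1) * x⌋ = 2 * a + 1}) := by
            rintro x ⟨hx, hx'⟩
            rw [← Set.inter_union_distrib_left]
            refine ⟨hx, ?_⟩
            simp only [Set.mem_ofPred_eq] at hx'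
            have := floor_two_mul_eq (2 ^ n * x)
            rw [← mul_assoc, ← pow_succ', hx'] at this
            exact this
          have hn' : n + 1 + i ∈ K := by rwa [Nat.add_assoc, Nat.add_comm 1 i]
          refine (measure_mono hsub).trans ((measure_union_le _ _).trans
            ((add_le_add (ihi _ _ hn') (ihi _ _ hn')).trans ?_))
          rw [← ENNReal.ofReal_add (by positivity) (by positivity)]
          refine ENNReal.ofReal_le_ofReal (le_of_eq ?_)
          ring
      intro n a
      obtain ⟨k, hk, hnk⟩ := hK.exists_gt n
      obtain ⟨i, rfl⟩ := Nat.exists_eq_add_of_le hnk.le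
      exact haux i n a hk
  have h0 : E ⊆ E ∩ {x | ⌊2 ^ 0 * x⌋ = 0} := fun x hx =>
    ⟨hx, by simpa using Int.floor_eq_zero_iff.2 hx.1⟩
  have hle : ∀ j, volume E ≤ ENNReal.ofReal ((1 / 2) ^ j) := fun j => by
    simpa using (measure_mono h0).trans (key j 0 0)
  refine le_antisymm (ge_of_tendsto' (x := atTop) ?_ hle) zero_le
  simpa only [ENNReal.ofReal_zero] using ENNReal.tendsto_ofReal tendsto_half_pow

/-! ### Gauge measures -/

/-- Only small diameters matter, so the gauge may be changed to ∞ from 1 on. This makes it monotone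
everywhere, as invariance under non-surjective isometries requires. -/
theorem gaugeMeasure_image {Y Z : Type*} [MetricSpace Y] [MeasurableSpace Y] [BorelSpace Y]
    [MetricSpace Z] [MeasurableSpace Z] [BorelSpace Z] {h : ℝ → ℝ}
    (hmono : MonotoneOn h (Set.Ico 0 1)) {f : Y → Z} (hf : Isometry f) (s : Set Y) :
    gaugeMeasure Z h (f '' s) = gaugeMeasure Y h s := by
  classical
  let m : ℝ≥0∞ → ℝ≥0∞ := fun r => ENNReal.ofReal (h r.toReal)
  let m' : ℝ≥0∞ → ℝ≥0∞ := fun r => if r < 1 then m r else ∞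
  have hm' : Monotone m' := by
    intro a b hab
    by_cases hb : b < 1
    · have ha := hab.trans_lt hb
      simp only [m', m, if_pos ha, if_pos hb]
      have h1 : ∀ c : ℝ≥0∞, c < 1 → c.toReal ∈ Set.Ico (0 : ℝ) 1 := fun c hc =>
        ⟨ENNReal.toReal_nonneg, by
          simpa using (ENNReal.toReal_lt_toReal hc.ne_top ENNReal.one_ne_top).2 hc⟩
      exact ENNReal.ofReal_le_ofReal (hmono (h1 a ha) (h1 b hb)
        (ENNReal.toReal_mono hb.ne_top hab))
    · simp [m', if_neg hb]
  have hev : m =ᶠ[𝓝 0] m' := by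
    filter_upwards [Iio_mem_nhds (zero_lt_one : (0 : ℝ≥0∞) < 1)] with r hr
    exact (if_pos hr).symm
  have hZ : gaugeMeasure Z h = Measure.mkMetric m' :=
    le_antisymm (Measure.mkMetric_mono hev.le) (Measure.mkMetric_mono hev.symm.le)
  have hY : gaugeMeasure Y h = Measure.mkMetric m' :=
    le_antisymm (Measure.mkMetric_mono hev.le) (Measure.mkMetric_mono hev.symm.le)
  rw [hZ, hY, ← OuterMeasure.coe_mkMetric, ← OuterMeasure.coe_mkMetric,
    ← OuterMeasure.isometry_comap_mkMetric m' hf (Or.inl hm'), OuterMeasure.comap_apply]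

theorem gaugeMeasure_singleton {Y : Type*} [MetricSpace Y] [MeasurableSpace Y] [BorelSpace Y]
    {h : ℝ → ℝ} (h0 : h 0 = 0) (x : Y) : gaugeMeasure Y h {x} = 0 := by
  refine le_antisymm ((Measure.mkMetric_le_liminf_sum (β := ℕ) (ι := fun _ => Unit) (l := atTop) {x}
    (fun _ => 0) tendsto_const_nhds (fun _ _ => {x}) (by simp) (by simp) _).trans ?_) zero_le
  simp [h0]

/-! ### Cantor sets with a gauge function -/

/-- The set of all sums `∑ b_j (e_j - e_{j+1})` with `b_j ∈ {0, 1}`. -/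
def cantorSet (e : ℕ → ℝ) : Set ℝ := {s | ∃ b, IsBit b ∧ gapTail e b 0 = s}

/-- The map that turns the binary digits of `x` into the coefficients of an element of the Cantor
set. -/
noncomputable def cantorMap (e : ℕ → ℝ) (x : ℝ) : ℝ := gapTail e (binDigit x) 0

/-- The uniform distribution on the Cantor set. -/
noncomputable def cantorMeasure (e : ℕ → ℝ) : Measure ℝ :=
  (volume.restrict (Set.Ico 0 1)).map (cantorMap e)

/-- The gauge function `h` fits to the Cantor set defined by the sequence `e`. -/
structure IsCantorGauge (e : ℕ → ℝ) (h : ℝ → ℝ) : Prop where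
  zero : e 0 = 1
  pos : ∀ k, 0 < e k
  quarter : ∀ k, 4 * e (k + 1) ≤ e k
  rational : ∀ k, e k ∈ (algebraMap ℚ ℝ).range
  gauge : IsGauge h
  mono : MonotoneOn h (Set.Ico 0 1)
  h_zero : h 0 = 0
  h_succ : ∀ k, h (e (k + 1)) = (1 / 2) ^ (k + 1)
  -- Controls the loss when an interval of length e_{k+1} is shortened by `v` and `w` at its two
  -- ends; it drives the mass estimate `sub_le`.
  concave : ∀ k v w, v ∈ Set.Icc 0 (e (k + 2)) → w ∈ Set.Icc 0 (e (k + 2)) →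
    h (e (k + 1)) - h (e (k + 1) - v - w) ≤ (h v + h w) / 2

section Cantor

variable {e : ℕ → ℝ} {h : ℝ → ℝ} (H : IsCantorGauge e h)

include H

theorem IsCantorGauge.antitone : Antitone e :=
  antitone_nat_of_succ_le fun k => by linarith [H.quarter k, H.pos (k + 1)]

theorem IsCantorGauge.tendsto : Tendsto e atTop (𝓝 0) := by
  have h1 : ∀ k, e k ≤ (1 / 2) ^ k := by
    intro k
    induction k with
    | zero => simp [H.zero]
    | succ k ih =>
      rw [pow_succ]
      linarith [H.quarter k, H.pos (k + 1)]
  exact squeeze_zero (fun k => (H.pos k).le) h1 tendsto_half_pow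

theorem IsCantorGauge.lt_one (k : ℕ) : e (k + 1) < 1 := by
  have h1 := H.antitone (show 1 ≤ k + 1 by omega)
  have h2 := H.quarter 0
  rw [H.zero] at h2
  simp only [zero_add] at h2
  linarith

theorem IsCantorGauge.gap (k : ℕ) : 2 * e (k + 1) < e k - e (k + 1) := by
  linarith [H.quarter k, H.pos (k + 1)]

theorem IsCantorGauge.gapTail_mem {b : ℕ → ℝ} (hb : IsBit b) (k : ℕ) :
    gapTail e b k ∈ Set.Icc 0 (e k) :=
  ⟨gapTail_nonneg H.antitone hb.nonneg k, hb.gapTail_le H.antitone H.tendsto k⟩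

theorem IsCantorGauge.cantorSet_subset : cantorSet e ⊆ Set.Icc 0 1 := by
  rintro _ ⟨b, hb, rfl⟩
  rw [← H.zero]
  exact H.gapTail_mem hb 0

/-- A continuous image of the compact space {0,1}^ℕ: the series converges uniformly, being dominated
by the gaps. -/
theorem IsCantorGauge.isCompact_cantorSet : IsCompact (cantorSet e) := by
  have h1 : cantorSet e = (fun b => gapTail e b 0) '' (Set.univ.pi fun _ : ℕ => ({0, 1} : Set ℝ)) := by
    ext s
    simp [cantorSet, IsBit]
  rw [h1]
  refine (isCompact_univ_pi fun _ => (Set.toFinite _).isCompact).image_of_continuousOn ?_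
  unfold gapTail
  refine continuousOn_tsum (fun j => by fun_prop) (hasSum_gap H.antitone H.tendsto 0).summable ?_
  intro j b hb
  have hb' : IsBit b := fun k => by simpa using hb k (Set.mem_univ k)
  rw [norm_mul, Real.norm_eq_abs, Real.norm_eq_abs,
    abs_of_nonneg (sub_nonneg.2 (H.antitone (Nat.le_succ (j + 0))))]
  exact mul_le_of_le_one_left (sub_nonneg.2 (H.antitone (Nat.le_succ (j + 0)))) (hb'.abs_le _)

theorem IsCantorGauge.measurableSet_cantorSet : MeasurableSet (cantorSet e) :=
  H.isCompact_cantorSet.isClosed.measurableSet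

/-- Flip all coefficients: the sum of all gaps is e_0 = 1. -/
theorem IsCantorGauge.one_sub_mem {s : ℝ} (hs : s ∈ cantorSet e) : 1 - s ∈ cantorSet e := by
  obtain ⟨b, hb, rfl⟩ := hs
  exact ⟨1 - b, hb.compl, by rw [gapTail_compl H.antitone H.tendsto hb.abs_le, H.zero]⟩

theorem IsCantorGauge.measurable_cantorMap : Measurable (cantorMap e) := by
  refine measurable_of_tendsto_metrizable
    (f := fun n x => ∑ j ∈ Finset.range n, binDigit x (j + 0) * (e (j + 0) - e (j + 0 + 1)))
    (fun n => ?_) (tendsto_pi_nhds.2 fun x => ?_)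
  · exact Finset.measurable_fun_sum _ fun j _ => (measurable_binDigit _).mul_const _
  · exact (summable_gap H.antitone H.tendsto (isBit_binDigit x).abs_le 0).hasSum.tendsto_sum_nat

/-- If the first nonzero bit of the tail is at n, the tail is at most e_n, so its gauge is at most
2^{-n}; the term at n alone contributes 2^{-n}/2 to the dyadic tail. Indices start at `k + 1`
because `h` is controlled only below e_0 = 1. -/
theorem IsCantorGauge.half_tail_le {b : ℕ → ℝ} (hb : IsBit b) (k : ℕ) :
    h (gapTail e b (k + 1)) / 2 ≤ gapTail (fun k => (1 / 2 : ℝ) ^ k) b (k + 1) := by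
  classical
  by_cases hex : ∃ i, b (k + 1 + i) ≠ 0
  · set i := Nat.find hex
    have hlt : ∀ j, k + 1 ≤ j → j < k + 1 + i → b j = 0 := by
      intro j hj hj'
      obtain ⟨l, rfl⟩ := Nat.exists_eq_add_of_le hj
      exact not_not.1 (Nat.find_min hex (by omega))
    have hi : b (k + 1 + i) = 1 := (hb _).resolve_left (Nat.find_spec hex)
    rw [gapTail_eq_of_zero H.antitone H.tendsto hb.abs_le (Nat.le_add_right (k + 1) i) hlt,
      gapTail_eq_of_zero antitone_half_pow tendsto_half_pow hb.abs_le (Nat.le_add_right (k + 1) i)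
        hlt, gapTail_eq_add antitone_half_pow tendsto_half_pow hb.abs_le (k + 1 + i), hi]
    have h1 := gapTail_nonneg antitone_half_pow hb.nonneg (k + 1 + i + 1)
    rw [Nat.add_right_comm k 1 i] at *
    have h2 := H.gapTail_mem hb (k + i + 1)
    have h3 := H.mono ⟨h2.1, h2.2.trans_lt (H.lt_one _)⟩ ⟨(H.pos _).le, H.lt_one _⟩ h2.2
    rw [H.h_succ] at h3
    rw [pow_succ _ (k + i + 1)]
    linarith
  · push Not at hex
    have h0 : ∀ e' : ℕ → ℝ, gapTail e' b (k + 1) = 0 := fun e' => by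
      have : ∀ j, b (j + (k + 1)) = 0 := fun j => by rw [add_comm]; exact hex j
      simp [gapTail, this]
    rw [h0, h0, H.h_zero]
    simp

/-- The mass of an interval between two points of the Cantor set is bounded by the gauge function of
its length. -/
theorem IsCantorGauge.sub_le {b c : ℕ → ℝ} (hb : IsBit b) (hc : IsBit c) {k : ℕ}
    (hbc : ∀ i < k + 1, b i = c i) (hbk : b (k + 1) = 0) (hck : c (k + 1) = 1) :
    gapTail (fun k => (1 / 2 : ℝ) ^ k) c 0 - gapTail (fun k => (1 / 2 : ℝ) ^ k) b 0 ≤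
      h (gapTail e c 0 - gapTail e b 0) := by
  have hcb : ∀ i < k + 1, c i = b i := fun i hi => (hbc i hi).symm
  rw [gapTail_sub_eq H.antitone H.tendsto hc.abs_le hb.abs_le hcb,
    gapTail_sub_eq antitone_half_pow tendsto_half_pow hc.abs_le hb.abs_le hcb,
    gapTail_eq_add H.antitone H.tendsto hc.abs_le, gapTail_eq_add H.antitone H.tendsto hb.abs_le,
    gapTail_eq_add antitone_half_pow tendsto_half_pow hc.abs_le,
    gapTail_eq_add antitone_half_pow tendsto_half_pow hb.abs_le, hbk, hck]
  -- Let v, w be the tails of `b` and `1 - c` from k+2 on. The distance in the Cantor set is e_{k+1}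
  -- - v - w. The dyadic distance is 2^{-(k+1)} minus the dyadic tails, hence at most h(e_{k+1}) -
  -- (h(v) + h(w))/2, and `concave` finishes.
  have h1 := H.half_tail_le hb (k + 1)
  have h2 := H.half_tail_le hc.compl (k + 1)
  have h3 := H.concave k _ _ (H.gapTail_mem hb (k + 1 + 1)) (H.gapTail_mem hc.compl (k + 1 + 1))
  rw [gapTail_compl antitone_half_pow tendsto_half_pow hc.abs_le] at h2
  rw [gapTail_compl H.antitone H.tendsto hc.abs_le] at h2 h3
  rw [H.h_succ] at h3
  rw [show 1 * (e (k + 1) - e (k + 1 + 1)) + gapTail e c (k + 1 + 1) -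
    (0 * (e (k + 1) - e (k + 1 + 1)) + gapTail e b (k + 1 + 1)) =
    e (k + 1) - gapTail e b (k + 1 + 1) - (e (k + 1 + 1) - gapTail e c (k + 1 + 1)) by ring]
  linarith

theorem IsCantorGauge.abs_sub_le {x y : ℝ} (hx : x ∈ Set.Ico (0 : ℝ) 1)
    (hy : y ∈ Set.Ico (0 : ℝ) 1) {r : ℝ} (hr : r ≤ 1 / 4) (hd : |cantorMap e x - cantorMap e y| ≤ r) :
    |x - y| ≤ h r := by
  wlog hxy : x ≤ y generalizing x y
  · rw [abs_sub_comm]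
    rw [abs_sub_comm] at hd
    exact this hy hx hd (not_le.1 hxy).le
  have hr0 : r ∈ Set.Ico (0 : ℝ) 1 := ⟨(abs_nonneg _).trans hd, by linarith⟩
  rcases hxy.eq_or_lt with rfl | hxy
  · rw [sub_self, abs_zero, ← H.h_zero]
    exact H.mono ⟨le_rfl, one_pos⟩ hr0 hr0.1
  rw [abs_sub_comm, abs_of_pos (sub_pos.2 hxy)]
  rw [abs_sub_comm] at hd
  obtain ⟨k, hk, hxk, hyk⟩ := exists_first_binDigit hx hy hxy
  have hbx := isBit_binDigit x
  have hby := isBit_binDigit y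
  rcases k with _ | k
  -- If the first digits differ, the images are at least 1 - 2 e_1 ≥ 1/2 apart, more than `r ≤ 1 /
  -- 4`.
  · exfalso
    have h1 := (le_abs_self _).trans hd
    rw [cantorMap, cantorMap, gapTail_eq_add H.antitone H.tendsto hbx.abs_le,
      gapTail_eq_add H.antitone H.tendsto hby.abs_le, hxk, hyk, H.zero, zero_add] at h1
    have h2 := H.gapTail_mem hbx 1
    have h3 := H.gapTail_mem hby 1
    have h4 := H.quarter 0
    rw [H.zero, zero_add] at h4
    linarith [h2.2, h3.1]
  · have h1 := H.sub_le hbx hby hk hxk hyk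
    rw [hasSum_binDigit hx, hasSum_binDigit hy] at h1
    have h2 : 0 ≤ cantorMap e y - cantorMap e x := by
      rw [cantorMap, cantorMap, gapTail_sub_eq H.antitone H.tendsto hby.abs_le hbx.abs_le
        (fun i hi => (hk i hi).symm), gapTail_eq_add H.antitone H.tendsto hby.abs_le,
        gapTail_eq_add H.antitone H.tendsto hbx.abs_le, hxk, hyk]
      have h2 := H.gapTail_mem hbx (k + 1 + 1)
      have h3 := H.gapTail_mem hby (k + 1 + 1)
      linarith [h2.2, h3.1, H.gap (k + 1), H.pos (k + 1 + 1)]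
    have h3 := (le_abs_self _).trans hd
    exact h1.trans (H.mono ⟨h2, h3.trans_lt hr0.2⟩ hr0 h3)

/-- Mass distribution principle: the preimage in [0,1) of a set of diameter r ≤ 1/4 has diameter,
hence Lebesgue measure, at most h(r). -/
theorem IsCantorGauge.cantorMeasure_le : cantorMeasure e ≤ gaugeMeasure ℝ h := by
  refine Measure.le_mkMetric _ _ (ENNReal.ofReal (1 / 4)) (by simp) fun I hI => ?_
  -- The closure has the same diameter and is measurable.
  rw [← Metric.ediam_closure] at hI ⊢
  refine (measure_mono subset_closure).trans ?_
  rw [cantorMeasure, Measure.map_apply H.measurable_cantorMap isClosed_closure.measurableSet,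
    Measure.restrict_apply (H.measurable_cantorMap isClosed_closure.measurableSet)]
  refine (Real.volume_le_diam _).trans (Metric.ediam_le ?_)
  rintro x ⟨hx, hx'⟩ y ⟨hy, hy'⟩
  have hfin : Metric.ediam (closure I) ≠ ∞ := ne_top_of_le_ne_top ENNReal.ofReal_ne_top hI
  rw [edist_dist, Real.dist_eq]
  refine ENNReal.ofReal_le_ofReal (H.abs_sub_le hx' hy' ?_ ?_)
  · simpa using ENNReal.toReal_mono ENNReal.ofReal_ne_top hI
  · rw [← Real.dist_eq, dist_edist]
    exact ENNReal.toReal_mono hfin (Metric.edist_le_ediam_of_mem hx hy)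

/-- Cover by the 2^n cylinders of level n, of diameter at most e_n: for n ≥ 1 the sum is at most 2^n
h(e_n) = 1. -/
theorem IsCantorGauge.gaugeMeasure_cantorSet_le : gaugeMeasure ℝ h (cantorSet e) ≤ 1 := by
  let t : ∀ n : ℕ, (Fin n → Fin 2) → Set ℝ := fun n p =>
    {s | ∃ b, IsBit b ∧ (∀ i : Fin n, b i = ((p i : ℕ) : ℝ)) ∧ gapTail e b 0 = s}
  have ht : ∀ n p, Metric.ediam (t n p) ≤ ENNReal.ofReal (e n) := by
    intro n p
    refine Metric.ediam_le ?_
    rintro _ ⟨b, hb, hbp, rfl⟩ _ ⟨c, hc, hcp, rfl⟩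
    rw [edist_dist, Real.dist_eq]
    refine ENNReal.ofReal_le_ofReal ?_
    rw [gapTail_sub_eq (k := n) H.antitone H.tendsto hb.abs_le hc.abs_le
      (fun i hi => (hbp ⟨i, hi⟩).trans (hcp ⟨i, hi⟩).symm)]
    have h1 := H.gapTail_mem hb n
    have h2 := H.gapTail_mem hc n
    rw [abs_le]
    constructor <;> linarith [h1.1, h1.2, h2.1, h2.2]
  refine (Measure.mkMetric_le_liminf_sum (l := atTop) (cantorSet e) (fun n => ENNReal.ofReal (e n))
    (by simpa using ENNReal.tendsto_ofReal H.tendsto) t (Eventually.of_forall ht)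
    (Eventually.of_forall fun n => ?_) _).trans ?_
  · rintro _ ⟨b, hb, rfl⟩
    refine Set.mem_iUnion.2 ⟨fun i => if b i = 0 then 0 else 1, b, hb, fun i => ?_, rfl⟩
    rcases hb i with h | h <;> simp [h]
  · refine (liminf_le_liminf (v := fun _ => (1 : ℝ≥0∞)) ?_).trans (liminf_const _).le
    filter_upwards [eventually_ge_atTop 1] with n hn
    obtain ⟨k, rfl⟩ := Nat.exists_eq_add_of_le' hn
    have h1 : ∀ p, ENNReal.ofReal (h (Metric.ediam (t (k + 1) p)).toReal) ≤
        ENNReal.ofReal ((1 / 2) ^ (k + 1)) := by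
      intro p
      rw [← H.h_succ]
      have h2 := ENNReal.toReal_mono ENNReal.ofReal_ne_top (ht (k + 1) p)
      rw [ENNReal.toReal_ofReal (H.pos _).le] at h2
      exact ENNReal.ofReal_le_ofReal (H.mono ⟨ENNReal.toReal_nonneg, h2.trans_lt (H.lt_one k)⟩
        ⟨(H.pos _).le, H.lt_one k⟩ h2)
    refine (Finset.sum_le_card_nsmul _ _ _ fun p _ => h1 p).trans (le_of_eq ?_)
    rw [Finset.card_univ, Fintype.card_fun, Fintype.card_fin, Fintype.card_fin, nsmul_eq_mul,
      ← ENNReal.ofReal_natCast, ← ENNReal.ofReal_mul (by positivity)]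
    push_cast
    rw [← mul_pow]
    norm_num

theorem IsCantorGauge.isProbabilityMeasure : IsProbabilityMeasure (cantorMeasure e) := by
  refine ⟨?_⟩
  rw [cantorMeasure, Measure.map_apply H.measurable_cantorMap MeasurableSet.univ]
  simp

/-- The uniform distribution is dominated by the restricted gauge measure, whose total mass is at
most 1; a probability measure below a measure of mass at most 1 equals it. -/
theorem IsCantorGauge.restrict_cantorSet :
    (gaugeMeasure ℝ h).restrict (cantorSet e) = cantorMeasure e := by
  have hp := H.isProbabilityMeasure
  have h1 : (cantorMeasure e).restrict (cantorSet e) = cantorMeasure e :=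
    Measure.restrict_eq_self_of_ae_mem ((ae_map_iff H.measurable_cantorMap.aemeasurable
      H.measurableSet_cantorSet).2 (ae_of_all _ fun x => ⟨_, isBit_binDigit x, rfl⟩))
  have h2 : cantorMeasure e ≤ (gaugeMeasure ℝ h).restrict (cantorSet e) := by
    rw [← h1]
    exact Measure.restrict_mono le_rfl H.cantorMeasure_le
  have h3 : (gaugeMeasure ℝ h).restrict (cantorSet e) Set.univ ≤ 1 := by
    rw [Measure.restrict_apply_univ]
    exact H.gaugeMeasure_cantorSet_le
  have h4 : (gaugeMeasure ℝ h).restrict (cantorSet e) Set.univ = cantorMeasure e Set.univ :=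
    le_antisymm (h3.trans_eq measure_univ.symm) (h2 _)
  exact (Measure.eq_of_le_of_measure_univ_eq h2 h4.symm).symm

/-- The Cantor set and its translates by irrational numbers have null intersections. -/
theorem IsCantorGauge.gaugeMeasure_inter_translate {t : ℝ} (ht : t ∉ (algebraMap ℚ ℝ).range) :
    gaugeMeasure ℝ h {s | s ∈ cantorSet e ∧ s - t ∈ cantorSet e} = 0 := by
  have hT : MeasurableSet {s | s - t ∈ cantorSet e} :=
    H.measurableSet_cantorSet.preimage (measurable_id.sub_const t)
  have h1 : {s | s ∈ cantorSet e ∧ s - t ∈ cantorSet e} = {s | s - t ∈ cantorSet e} ∩ cantorSet e :=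
    Set.inter_comm _ _
  rw [h1, ← Measure.restrict_apply hT, H.restrict_cantorSet, cantorMeasure,
    Measure.map_apply H.measurable_cantorMap hT,
    Measure.restrict_apply (H.measurable_cantorMap hT)]
  by_cases hne : (cantorMap e ⁻¹' {s | s - t ∈ cantorSet e} ∩ Set.Ico 0 1).Nonempty
  swap
  · rw [Set.not_nonempty_iff_eq_empty.1 hne, measure_empty]
  obtain ⟨x₀, ⟨c₀, hc₀, hxc₀⟩, hx₀⟩ := hne
  have hdiff : ∀ {b c : ℕ → ℝ}, IsBit b → IsBit c → ∀ k, |(b - c) k| ≤ 1 := by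
    intro b c hb hc k
    rcases hb k with h | h <;> rcases hc k with h' | h' <;> simp [h, h']
  have ht₀ : t = gapTail e (binDigit x₀ - c₀) 0 := by
    rw [gapTail_sub H.antitone H.tendsto (isBit_binDigit x₀).abs_le hc₀.abs_le, hxc₀, cantorMap]
    ring
  -- A finite sum of rational gaps would make `t` rational.
  have hK : {k | (binDigit x₀ - c₀) k ≠ 0}.Infinite := by
    intro hfin
    refine ht ?_
    rw [ht₀, gapTail, tsum_eq_sum (s := hfin.toFinset)]
    · refine sum_mem fun k _ => mul_mem ?_ (sub_mem (H.rational _) (H.rational _))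
      rw [Pi.sub_apply]
      refine sub_mem ?_ ?_
      · rcases isBit_binDigit x₀ (k + 0) with h | h <;> rw [h]
        exacts [zero_mem _, one_mem _]
      · rcases hc₀ (k + 0) with h | h <;> rw [h]
        exacts [zero_mem _, one_mem _]
    · intro k hk
      have : (binDigit x₀ - c₀) k = 0 := by simpa using hk
      rw [add_zero, this, zero_mul]
  refine measure_mono_null ?_ (volume_binDigit_eq hK (binDigit x₀))
  rintro x ⟨⟨c, hc, hxc⟩, hx⟩
  refine ⟨hx, fun k hk => ?_⟩
  have htx : t = gapTail e (binDigit x - c) 0 := by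
    rw [gapTail_sub H.antitone H.tendsto (isBit_binDigit x).abs_le hc.abs_le, hxc, cantorMap]
    ring
  -- Two expansions of `t` with coefficients in {-1, 0, 1} differ by an expansion of 0 with integer
  -- coefficients bounded by 2, so they coincide. A coefficient 1 or -1 then forces the digit of `x`
  -- to be 1 or 0.
  have hz := eq_zero_of_gapTail_eq_zero H.antitone H.tendsto (B := 2)
    (b := binDigit x - c - (binDigit x₀ - c₀)) H.gap (fun k => ?_) (fun k => ?_) ?_ k
  · have hk' : (binDigit x₀ - c₀) k ≠ 0 := hk
    simp only [Pi.sub_apply] at hz hk'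
    rcases isBit_binDigit x k with h1 | h1 <;> rcases isBit_binDigit x₀ k with h2 | h2 <;>
      rcases hc k with h3 | h3 <;> rcases hc₀ k with h4 | h4 <;>
      rw [h1, h2, h3, h4] at hz <;> rw [h2, h4] at hk' <;> rw [h1, h2] <;>
      first | (norm_num at hz; done) | norm_num at hk'
  · have h1 := hdiff (isBit_binDigit x) hc k
    have h2 := hdiff (isBit_binDigit x₀) hc₀ k
    exact (abs_sub _ _).trans (by linarith)
  · simp only [Pi.sub_apply]
    rcases isBit_binDigit x k with h1 | h1 <;> rcases isBit_binDigit x₀ k with h2 | h2 <;>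
      rcases hc k with h3 | h3 <;> rcases hc₀ k with h4 | h4 <;>
      rw [h1, h2, h3, h4] <;> norm_num
  · rw [gapTail_sub H.antitone H.tendsto (hdiff (isBit_binDigit x) hc)
      (hdiff (isBit_binDigit x₀) hc₀), ← htx, ← ht₀, sub_self]

end Cantor

/-! ### The graphoning of a Cantor set -/

theorem isometry_const_add (x : ℝ) : Isometry fun s : ℝ => x + s :=
  Isometry.of_dist_eq fun a b => by simp

theorem isometry_const_sub (x : ℝ) : Isometry fun s : ℝ => x - s :=
  Isometry.of_dist_eq fun a b => by
    rw [Real.dist_eq, Real.dist_eq, sub_sub_sub_cancel_left, abs_sub_comm]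

theorem abs_mem_iff_of_nonneg {S : Set ℝ} (hS : ∀ s ∈ S, 0 ≤ s) (t : ℝ) :
    |t| ∈ S ↔ t ∈ S ∨ -t ∈ S := by
  constructor
  · intro h
    rcases abs_choice t with h' | h' <;> rw [h'] at h
    exacts [Or.inl h, Or.inr h]
  · rintro (h | h)
    · rwa [abs_of_nonneg (hS _ h)]
    · rwa [abs_of_nonpos (neg_nonneg.1 (hS _ h))]

theorem volume_unitInterval_eq_hausdorff : (volume : Measure unitInterval) = μH[1] := by
  ext s hs
  have h1 : (volume : Measure unitInterval) s = volume ((fun x : unitInterval => (x : ℝ)) '' s) :=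
    comap_subtype_coe_apply measurableSet_Icc volume s
  have h2 : Isometry (fun x : unitInterval => (x : ℝ)) := isometry_subtype_coe
  rw [h1, ← hausdorffMeasure_real, h2.hausdorffMeasure_image (Or.inl zero_le_one)]

section Cantor

variable {e : ℕ → ℝ} {h : ℝ → ℝ} (H : IsCantorGauge e h)

include H

theorem IsCantorGauge.cantorMeasure_apply {T : Set ℝ} (hT : MeasurableSet T) :
    cantorMeasure e T = gaugeMeasure ℝ h (T ∩ cantorSet e) := by
  rw [← H.restrict_cantorSet, Measure.restrict_apply hT]

theorem IsCantorGauge.gaugeMeasure_cantorSet : gaugeMeasure ℝ h (cantorSet e) = 1 := by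
  have := H.isProbabilityMeasure
  have h1 := H.cantorMeasure_apply MeasurableSet.univ
  rwa [Set.univ_inter, measure_univ, eq_comm] at h1

theorem IsCantorGauge.cantorMeasure_singleton (x : ℝ) : cantorMeasure e {x} = 0 := by
  rw [H.cantorMeasure_apply (measurableSet_singleton x)]
  exact measure_mono_null Set.inter_subset_left (gaugeMeasure_singleton H.h_zero x)

theorem IsCantorGauge.cantorMeasure_reflect {T : Set ℝ} (hT : MeasurableSet T) :
    cantorMeasure e {s | 1 - s ∈ T} = cantorMeasure e T := by
  have hm : MeasurableSet {s : ℝ | 1 - s ∈ T} := hT.preimage (by fun_prop)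
  rw [H.cantorMeasure_apply hm, H.cantorMeasure_apply hT,
    ← gaugeMeasure_image H.mono (isometry_const_sub 1)]
  congr 1
  ext y
  constructor
  · rintro ⟨s, ⟨hs, hs'⟩, rfl⟩
    exact ⟨hs, H.one_sub_mem hs'⟩
  · rintro ⟨hy, hy'⟩
    exact ⟨1 - y, ⟨by simpa using hy, H.one_sub_mem hy'⟩, by simp⟩

theorem IsCantorGauge.gaugeMeasure_preimage_cantorSet :
    gaugeMeasure unitInterval h ((fun x : unitInterval => (x : ℝ)) ⁻¹' cantorSet e) = 1 := by
  rw [← gaugeMeasure_image H.mono (isometry_subtype_coe (s := unitInterval)),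
    Set.image_preimage_eq_of_subset, H.gaugeMeasure_cantorSet]
  rw [Subtype.range_coe]
  exact H.cantorSet_subset

/-- Neighbors of x are points x + s and x - s with s in the Cantor set; the two kinds overlap at
most in x, a null set, and isometries carry each kind to the Cantor set. -/
theorem IsCantorGauge.degree_eq {A : Set unitInterval} (hA : MeasurableSet A) (x : unitInterval) :
    (differenceGraphoning (cantorSet e) h).degree A x =
      cantorMeasure e {s | (x : ℝ) + s ∈ ((↑) '' A : Set ℝ)} +
        cantorMeasure e {s | (x : ℝ) - s ∈ ((↑) '' A : Set ℝ)} := by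
  have hA' : MeasurableSet ((↑) '' A : Set ℝ) := measurableSet_Icc.subtype_image hA
  have hS := H.measurableSet_cantorSet
  have hS0 : ∀ s ∈ cantorSet e, 0 ≤ s := fun s hs => (H.cantorSet_subset hs).1
  have hB : MeasurableSet {y : unitInterval | |(x : ℝ) - y| ∈ cantorSet e} :=
    hS.preimage (by fun_prop)
  have h1 : (differenceGraphoning (cantorSet e) h).degree A x =
      gaugeMeasure unitInterval h ({y : unitInterval | |(x : ℝ) - y| ∈ cantorSet e} ∩ A) := by
    rw [GraphoningData.degree, ← Measure.restrict_apply hB, ← lintegral_indicator_one hB]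
    refine lintegral_congr fun y => ?_
    by_cases hy : |(x : ℝ) - y| ∈ cantorSet e <;> simp [differenceGraphoning, hy]
  have h2 : ((↑) '' ({y : unitInterval | |(x : ℝ) - y| ∈ cantorSet e} ∩ A) : Set ℝ) =
      {y | y ∈ ((↑) '' A : Set ℝ) ∧ y - x ∈ cantorSet e} ∪
        {y | y ∈ ((↑) '' A : Set ℝ) ∧ x - y ∈ cantorSet e} := by
    ext y
    constructor
    · rintro ⟨y, ⟨hy, hyA⟩, rfl⟩
      rcases (abs_mem_iff_of_nonneg hS0 _).1 hy with hy | hy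
      · exact Or.inr ⟨⟨y, hyA, rfl⟩, hy⟩
      · exact Or.inl ⟨⟨y, hyA, rfl⟩, by rwa [neg_sub] at hy⟩
    · rintro (⟨⟨y, hyA, rfl⟩, hy⟩ | ⟨⟨y, hyA, rfl⟩, hy⟩)
      · exact ⟨y, ⟨(abs_mem_iff_of_nonneg hS0 _).2 (Or.inr (by rwa [neg_sub])), hyA⟩, rfl⟩
      · exact ⟨y, ⟨(abs_mem_iff_of_nonneg hS0 _).2 (Or.inl hy), hyA⟩, rfl⟩
  have h3 : gaugeMeasure ℝ h ({y | y ∈ ((↑) '' A : Set ℝ) ∧ y - x ∈ cantorSet e} ∩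
      {y | y ∈ ((↑) '' A : Set ℝ) ∧ x - y ∈ cantorSet e}) = 0 := by
    refine measure_mono_null ?_ (gaugeMeasure_singleton H.h_zero (x : ℝ))
    rintro y ⟨⟨-, h1⟩, ⟨-, h2⟩⟩
    have h3 := hS0 _ h1
    have h4 := hS0 _ h2
    exact le_antisymm (by linarith) (by linarith)
  have h4 : MeasurableSet {y : ℝ | y ∈ ((↑) '' A : Set ℝ) ∧ x - y ∈ cantorSet e} :=
    hA'.inter (hS.preimage (measurable_id.const_sub _))
  rw [h1, ← gaugeMeasure_image H.mono (isometry_subtype_coe (s := unitInterval)), h2]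
  have h5 := measure_union_add_inter (μ := gaugeMeasure ℝ h)
    {y : ℝ | y ∈ ((↑) '' A : Set ℝ) ∧ y - x ∈ cantorSet e} h4
  rw [h3, add_zero] at h5
  have h6 : MeasurableSet {s : ℝ | (x : ℝ) + s ∈ ((↑) '' A : Set ℝ)} := hA'.preimage (by fun_prop)
  have h7 : MeasurableSet {s : ℝ | (x : ℝ) - s ∈ ((↑) '' A : Set ℝ)} := hA'.preimage (by fun_prop)
  rw [h5, H.cantorMeasure_apply h6, H.cantorMeasure_apply h7,
    ← gaugeMeasure_image H.mono (isometry_const_add x) ({s : ℝ | (x : ℝ) + s ∈ _} ∩ _),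
    ← gaugeMeasure_image H.mono (isometry_const_sub x) ({s : ℝ | (x : ℝ) - s ∈ _} ∩ _)]
  congr 2
  · ext y
    constructor
    · rintro ⟨hy, hy'⟩
      exact ⟨y - x, ⟨by rwa [Set.mem_ofPred_eq, add_sub_cancel], hy'⟩, by simp⟩
    · rintro ⟨s, ⟨hs, hs'⟩, rfl⟩
      exact ⟨hs, by simpa using hs'⟩
  · ext y
    constructor
    · rintro ⟨hy, hy'⟩
      exact ⟨x - y, ⟨by rwa [Set.mem_ofPred_eq, sub_sub_cancel], hy'⟩, by simp⟩
    · rintro ⟨s, ⟨hs, hs'⟩, rfl⟩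
      exact ⟨hs, by simpa using hs'⟩

/-- The upward steps are those with s ≤ 1 - x, the downward ones those with s ≤ x. Reflection turns
the latter into s ≥ 1 - x, so together they exhaust the Cantor set, overlapping in one null point.
-/
theorem IsCantorGauge.degree_univ (x : unitInterval) :
    (differenceGraphoning (cantorSet e) h).degree Set.univ x = 1 := by
  rw [H.degree_eq MeasurableSet.univ, Set.image_univ, Subtype.range_coe]
  have hx := x.2
  have h1 : {s : ℝ | (x : ℝ) + s ∈ unitInterval} = Set.Icc (-(x : ℝ)) (1 - x) := by
    ext s
    simp only [Set.mem_ofPred_eq, unitInterval, Set.mem_Icc]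
    constructor <;> rintro ⟨h1, h2⟩ <;> constructor <;> linarith
  have h2 : {s : ℝ | (x : ℝ) - s ∈ unitInterval} =
      {s | 1 - s ∈ Set.Icc (1 - (x : ℝ)) (2 - x)} := by
    ext s
    simp only [Set.mem_ofPred_eq, unitInterval, Set.mem_Icc]
    constructor <;> rintro ⟨h1, h2⟩ <;> constructor <;> linarith
  have h3 := measure_union_add_inter (μ := cantorMeasure e) (Set.Icc (-(x : ℝ)) (1 - x))
    (measurableSet_Icc (a := 1 - (x : ℝ)) (b := 2 - x))
  rw [Set.Icc_union_Icc_eq_Icc (by linarith [hx.2]) (by linarith)] at h3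
  have h4 : cantorMeasure e (Set.Icc (-(x : ℝ)) (1 - x) ∩ Set.Icc (1 - (x : ℝ)) (2 - x)) = 0 := by
    refine measure_mono_null ?_ (H.cantorMeasure_singleton (1 - x))
    rintro s ⟨hs, hs'⟩
    exact le_antisymm hs.2 hs'.1
  have h5 : cantorMeasure e (Set.Icc (-(x : ℝ)) (2 - x)) = 1 := by
    rw [H.cantorMeasure_apply measurableSet_Icc, Set.inter_eq_right.2, H.gaugeMeasure_cantorSet]
    intro s hs
    have := H.cantorSet_subset hs
    exact ⟨by linarith [hx.1, this.1], by linarith [hx.2, this.2]⟩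
  rw [h1, h2, H.cantorMeasure_reflect measurableSet_Icc, ← h3, h4, h5, add_zero]

theorem IsCantorGauge.degree_measurable {A : Set unitInterval} (hA : MeasurableSet A) :
    Measurable ((differenceGraphoning (cantorSet e) h).degree A) := by
  have := H.isProbabilityMeasure
  have hA' : MeasurableSet ((↑) '' A : Set ℝ) := measurableSet_Icc.subtype_image hA
  rw [funext fun x => H.degree_eq hA x]
  have h1 : MeasurableSet {p : unitInterval × ℝ | (p.1 : ℝ) + p.2 ∈ ((↑) '' A : Set ℝ)} :=
    hA'.preimage (by fun_prop)
  have h2 : MeasurableSet {p : unitInterval × ℝ | (p.1 : ℝ) - p.2 ∈ ((↑) '' A : Set ℝ)} :=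
    hA'.preimage (by fun_prop)
  exact (measurable_measure_prodMk_left h1).add (measurable_measure_prodMk_left h2)

/-- The right side is symmetric in `A` and `B` up to the order of the summands, which is
reversibility. -/
theorem IsCantorGauge.setLIntegral_degree {A B : Set unitInterval} (hA : MeasurableSet A)
    (hB : MeasurableSet B) :
    ∫⁻ x in A, (differenceGraphoning (cantorSet e) h).degree B x =
      (volume.prod (cantorMeasure e))
        {p : ℝ × ℝ | p.1 ∈ ((↑) '' A : Set ℝ) ∧ p.1 + p.2 ∈ ((↑) '' B : Set ℝ)} +
      (volume.prod (cantorMeasure e))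
        {p : ℝ × ℝ | p.1 ∈ ((↑) '' B : Set ℝ) ∧ p.1 + p.2 ∈ ((↑) '' A : Set ℝ)} := by
  have := H.isProbabilityMeasure
  have hA' : MeasurableSet ((↑) '' A : Set ℝ) := measurableSet_Icc.subtype_image hA
  have hB' : MeasurableSet ((↑) '' B : Set ℝ) := measurableSet_Icc.subtype_image hB
  have hm1 : MeasurableSet
      {p : ℝ × ℝ | p.1 ∈ ((↑) '' A : Set ℝ) ∧ p.1 + p.2 ∈ ((↑) '' B : Set ℝ)} :=
    (hA'.preimage measurable_fst).inter (hB'.preimage (by fun_prop))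
  have hm2 : MeasurableSet
      {p : ℝ × ℝ | p.1 ∈ ((↑) '' A : Set ℝ) ∧ p.1 - p.2 ∈ ((↑) '' B : Set ℝ)} :=
    (hA'.preimage measurable_fst).inter (hB'.preimage (by fun_prop))
  have hm3 : MeasurableSet
      {p : ℝ × ℝ | p.1 ∈ ((↑) '' B : Set ℝ) ∧ p.1 + p.2 ∈ ((↑) '' A : Set ℝ)} :=
    (hB'.preimage measurable_fst).inter (hA'.preimage (by fun_prop))
  -- For fixed s, translating the Lebesgue variable by s turns a step up from `B` to `A` into a step
  -- down from `A` to `B`.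
  have hshift : (volume.prod (cantorMeasure e))
      {p : ℝ × ℝ | p.1 ∈ ((↑) '' B : Set ℝ) ∧ p.1 + p.2 ∈ ((↑) '' A : Set ℝ)} =
      (volume.prod (cantorMeasure e))
      {p : ℝ × ℝ | p.1 ∈ ((↑) '' A : Set ℝ) ∧ p.1 - p.2 ∈ ((↑) '' B : Set ℝ)} := by
    rw [Measure.prod_apply_symm hm3, Measure.prod_apply_symm hm2]
    refine lintegral_congr fun s => ?_
    refine Eq.trans ?_ (measure_preimage_add_right volume s _)
    congr 1
    ext x
    change x ∈ ((↑) '' B : Set ℝ) ∧ x + s ∈ ((↑) '' A : Set ℝ) ↔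
      x + s ∈ ((↑) '' A : Set ℝ) ∧ x + s - s ∈ ((↑) '' B : Set ℝ)
    rw [add_sub_cancel_right, and_comm]
  have hfst : Measurable fun x : ℝ => cantorMeasure e {s | x + s ∈ ((↑) '' B : Set ℝ)} :=
    measurable_measure_prodMk_left (ν := cantorMeasure e)
      (s := {p : ℝ × ℝ | p.1 + p.2 ∈ ((↑) '' B : Set ℝ)}) (hB'.preimage (by fun_prop))
  have hsub : ∫⁻ x in A, (differenceGraphoning (cantorSet e) h).degree B x =
      ∫⁻ x in ((↑) '' A : Set ℝ), (cantorMeasure e {s | x + s ∈ ((↑) '' B : Set ℝ)} +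
        cantorMeasure e {s | x - s ∈ ((↑) '' B : Set ℝ)}) := by
    simp_rw [H.degree_eq hB]
    exact setLIntegral_subtype measurableSet_Icc A fun x : ℝ =>
      cantorMeasure e {s | x + s ∈ ((↑) '' B : Set ℝ)} +
        cantorMeasure e {s | x - s ∈ ((↑) '' B : Set ℝ)}
  rw [hshift, hsub, lintegral_add_left hfst, Measure.prod_apply hm1, Measure.prod_apply hm2,
    ← lintegral_indicator hA', ← lintegral_indicator hA']
  congr 1
  · refine lintegral_congr fun x => ?_
    by_cases hx : x ∈ ((↑) '' A : Set ℝ)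
    · rw [Set.indicator_of_mem hx]
      congr 1
      ext s
      exact ⟨fun h => ⟨hx, h⟩, fun h => h.2⟩
    · rw [Set.indicator_of_notMem hx, eq_comm]
      exact measure_mono_null (fun s hs => absurd hs.1 hx) measure_empty
  · refine lintegral_congr fun x => ?_
    by_cases hx : x ∈ ((↑) '' A : Set ℝ)
    · rw [Set.indicator_of_mem hx]
      congr 1
      ext s
      exact ⟨fun h => ⟨hx, h⟩, fun h => h.2⟩
    · rw [Set.indicator_of_notMem hx, eq_comm]
      exact measure_mono_null (fun s hs => absurd hs.1 hx) measure_empty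

theorem IsCantorGauge.isGraphoning : (differenceGraphoning (cantorSet e) h).IsGraphoning where
  prob := inferInstanceAs (IsProbabilityMeasure (volume : Measure unitInterval))
  W_measurable := (measurable_const.indicator H.measurableSet_cantorSet).comp
    (by fun_prop : Measurable fun p : unitInterval × unitInterval => |(p.1 : ℝ) - p.2|)
  W_mem x y := by
    by_cases hy : |(x : ℝ) - y| ∈ cantorSet e <;> simp [differenceGraphoning, hy]
  W_symm x y := by simp only [differenceGraphoning, abs_sub_comm]
  degree_bound x := (H.degree_univ x).le
  degree_measurable A hA := H.degree_measurable hA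
  measure_preserving A B hA hB := by
    change ∫⁻ x in A, _ = ∫⁻ x in B, _
    rw [H.setLIntegral_degree hA hB, H.setLIntegral_degree hB hA, add_comm]

theorem IsCantorGauge.cantorMeasure_translate {t : ℝ} (ht : t ∉ (algebraMap ℚ ℝ).range) :
    cantorMeasure e {s | s - t ∈ cantorSet e} = 0 := by
  have hm : MeasurableSet {s | s - t ∈ cantorSet e} :=
    H.measurableSet_cantorSet.preimage (by fun_prop)
  rw [H.cantorMeasure_apply hm]
  rw [Set.inter_comm]
  exact H.gaugeMeasure_inter_translate ht

/-- Points with irrational difference have no common neighbors, up to null sets. -/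
theorem IsCantorGauge.deg_neighborhood {x z : unitInterval}
    (hxz : (z : ℝ) - x ∉ (algebraMap ℚ ℝ).range) :
    (differenceGraphoning (cantorSet e) h).toPseudo.deg x
      {y | (differenceGraphoning (cantorSet e) h).toPseudo.W z y ≠ 0} = 0 := by
  have hS0 : ∀ s ∈ cantorSet e, 0 ≤ s := fun s hs => (H.cantorSet_subset hs).1
  have hT : {y | (differenceGraphoning (cantorSet e) h).toPseudo.W z y ≠ 0} =
      {y : unitInterval | |(z : ℝ) - y| ∈ cantorSet e} := by
    ext y
    simp [GraphoningData.toPseudo, differenceGraphoning]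
  have hTm : MeasurableSet {y : unitInterval | |(z : ℝ) - y| ∈ cantorSet e} :=
    H.measurableSet_cantorSet.preimage (by fun_prop)
  have hneg : (x : ℝ) - z ∉ (algebraMap ℚ ℝ).range := fun hm => hxz (by
    rw [← neg_sub]; exact neg_mem hm)
  -- A common neighbor on the same side of both points puts s in a translate of the Cantor set by z
  -- - x (or x - z). On opposite sides it gives a reflected copy, which `one_sub_mem` makes a
  -- translate with shift changed by 1.
  have hone : ∀ t : ℝ, t ∉ (algebraMap ℚ ℝ).range → t - 1 ∉ (algebraMap ℚ ℝ).range :=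
    fun t ht hm => ht (by simpa using add_mem hm (one_mem _))
  rw [hT, GraphoningData.toPseudo_deg _ _ hTm, H.degree_eq hTm, add_eq_zero]
  constructor
  · refine measure_mono_null ?_ (measure_union_null (H.cantorMeasure_translate hxz)
      (H.cantorMeasure_translate (hone _ hxz)))
    rintro s ⟨y, hy, hys⟩
    rcases (abs_mem_iff_of_nonneg hS0 _).1 hy with hy | hy
    · right
      have := H.one_sub_mem hy
      rw [hys] at this
      rwa [show 1 - ((z : ℝ) - (x + s)) = s - (z - x - 1) by ring] at this
    · left
      rw [hys] at hy
      rwa [show -((z : ℝ) - (x + s)) = s - (z - x) by ring] at hy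
  · refine measure_mono_null ?_ (measure_union_null (H.cantorMeasure_translate hneg)
      (H.cantorMeasure_translate (hone _ hneg)))
    rintro s ⟨y, hy, hys⟩
    rcases (abs_mem_iff_of_nonneg hS0 _).1 hy with hy | hy
    · left
      rw [hys] at hy
      rwa [show (z : ℝ) - (x - s) = s - (x - z) by ring] at hy
    · right
      have := H.one_sub_mem hy
      rw [hys] at this
      rwa [show 1 - -((z : ℝ) - (x - s)) = s - (x - z - 1) by ring] at this

/-- The set is countable and points have gauge measure 0. -/
theorem IsCantorGauge.deg_rational (x z : unitInterval) :
    (differenceGraphoning (cantorSet e) h).toPseudo.deg x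
      {y | (z : ℝ) - y ∈ (algebraMap ℚ ℝ).range} = 0 := by
  refine withDensity_absolutelyContinuous _ _ ?_
  have hc : {y : unitInterval | (z : ℝ) - y ∈ (algebraMap ℚ ℝ).range}.Countable := by
    have h1 : Function.Injective fun y : unitInterval => (z : ℝ) - y := fun a b hab =>
      Subtype.ext (sub_right_injective hab)
    have h2 : ((algebraMap ℚ ℝ).range : Set ℝ).Countable := by
      rw [RingHom.coe_range]
      exact Set.countable_range _
    exact h2.preimage h1
  rw [← Set.biUnion_of_singleton {y : unitInterval | (z : ℝ) - y ∈ (algebraMap ℚ ℝ).range},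
    measure_biUnion_null_iff hc]
  exact fun y _ => gaugeMeasure_singleton H.h_zero y

theorem IsCantorGauge.isHausdorff : (differenceGraphoning (cantorSet e) h).IsHausdorff h where
  graphoning := H.isGraphoning
  gauge := H.gauge
  lam_eq := volume_unitInterval_eq_hausdorff
  mu_eq := rfl

theorem IsCantorGauge.isEuclideanLimit {V : ℕ → Type*} {G : ∀ n, SimpleGraph (V n)} {d : ℕ → ℕ}
    (hG : ∀ n, IsSparseRegular (G n) (d n)) (hd : Tendsto d atTop atTop)
    (hgrowth : Asymptotics.IsEquivalent atTop (fun n => h (1 / (Nat.card (V n) : ℝ)))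
      (fun n => 1 / (d n : ℝ))) :
    IsEuclideanLimit G (fun n => (d n : ℝ)) (differenceGraphoning (cantorSet e) h) h where
  limit := isLimit_of_isSparseRegular hG hd H.isGraphoning.isPseudoGraphoning
    (fun x => by rw [GraphoningData.toPseudo_deg _ _ MeasurableSet.univ, H.degree_univ])
    (R := fun x y => (x : ℝ) - y ∈ (algebraMap ℚ ℝ).range)
    (fun x y hxy => by rw [← neg_sub]; exact neg_mem hxy)
    H.deg_rational (fun x z => H.deg_neighborhood)
  euclidean := H.isHausdorff
  growth := hgrowth

end Cantor

/-! ### Binary expansions with constant blocks -/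

/-- The sums `∑ a_j 2^{-j}` whose digits are constant on the blocks `M k < j ≤ M (k + 1)`. -/
def blockSet (M : ℕ → ℕ) : Set ℝ :=
  {s | ∃ a : ℕ → Fin 2, (∀ k, ∀ i ∈ Set.Ioc (M k) (M (k + 1)), ∀ j ∈ Set.Ioc (M k) (M (k + 1)),
      a i = a j) ∧ HasSum (fun j : ℕ => ((a (j + 1) : ℕ) : ℝ) * (1 / 2) ^ (j + 1)) s}

theorem sum_Ico_half_pow {m n : ℕ} (h : m ≤ n) :
    ∑ j ∈ Finset.Ico m n, (1 / 2 : ℝ) ^ (j + 1) = (1 / 2) ^ m - (1 / 2) ^ n := by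
  induction n, h using Nat.le_induction with
  | base => simp
  | succ n h ih =>
    rw [Finset.sum_Ico_succ_top h, ih]
    ring

/-- The weights 2^{-j} of block k add up to e_k - e_{k+1}; comparing partial sums at block ends
identifies the two series. -/
theorem hasSum_blocks {M : ℕ → ℕ} (hM0 : M 0 = 0) (hM : StrictMono M) {a : ℕ → Fin 2} {b : ℕ → ℝ}
    (hab : ∀ k, ∀ i ∈ Set.Ioc (M k) (M (k + 1)), ((a i : ℕ) : ℝ) = b k) (hb : IsBit b) :
    HasSum (fun j : ℕ => ((a (j + 1) : ℕ) : ℝ) * (1 / 2) ^ (j + 1))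
      (gapTail (fun k => (1 / 2 : ℝ) ^ M k) b 0) := by
  have hanti : Antitone fun k => (1 / 2 : ℝ) ^ M k := antitone_half_pow.comp_monotone hM.monotone
  have htend : Tendsto (fun k => (1 / 2 : ℝ) ^ M k) atTop (𝓝 0) :=
    tendsto_half_pow.comp hM.tendsto_atTop
  have hsum : Summable fun j : ℕ => ((a (j + 1) : ℕ) : ℝ) * (1 / 2) ^ (j + 1) := by
    refine Summable.of_nonneg_of_le (fun j => by positivity) (fun j => ?_)
      ((summable_nat_add_iff 1).2 summable_geometric_two)
    refine mul_le_of_le_one_left (by positivity) ?_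
    exact_mod_cast Nat.lt_succ_iff.1 (a (j + 1)).2
  have hpart : ∀ n, ∑ j ∈ Finset.range (M n), ((a (j + 1) : ℕ) : ℝ) * (1 / 2) ^ (j + 1) =
      ∑ k ∈ Finset.range n, b (k + 0) * ((1 / 2) ^ M (k + 0) - (1 / 2) ^ M (k + 0 + 1)) := by
    intro n
    induction n with
    | zero => simp [hM0]
    | succ n ih =>
      have hle : M n ≤ M (n + 1) := (hM n.lt_succ_self).le
      rw [Finset.sum_range_succ, ← ih, add_zero, ← sum_Ico_half_pow hle,
        ← Finset.sum_range_add_sum_Ico _ hle, Finset.mul_sum]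
      congr 1
      refine Finset.sum_congr rfl fun j hj => ?_
      rw [Finset.mem_Ico] at hj
      rw [hab n (j + 1) ⟨by omega, by omega⟩]
  have h1 := hsum.hasSum.tendsto_sum_nat.comp hM.tendsto_atTop
  have h2 := (summable_gap hanti htend hb.abs_le 0).hasSum.tendsto_sum_nat
  have h3 := tendsto_nhds_unique (h1.congr hpart) h2
  rw [gapTail, ← h3]
  exact hsum.hasSum

theorem blockSet_eq_cantorSet {M : ℕ → ℕ} (hM0 : M 0 = 0) (hM : StrictMono M) :
    blockSet M = cantorSet fun k => (1 / 2 : ℝ) ^ M k := by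
  classical
  ext s
  constructor
  · rintro ⟨a, ha, hs⟩
    have hb : IsBit fun k => ((a (M (k + 1)) : ℕ) : ℝ) := by
      intro k
      have h2 : ∀ c : Fin 2, ((c : ℕ) : ℝ) = 0 ∨ ((c : ℕ) : ℝ) = 1 := by
        intro c
        fin_cases c <;> simp
      exact h2 _
    refine ⟨_, hb, (hasSum_blocks hM0 hM (fun k i hi => ?_) hb).unique hs⟩
    rw [ha k i hi (M (k + 1)) ⟨hM k.lt_succ_self, le_rfl⟩]
  · rintro ⟨b, hb, rfl⟩
    -- `idx i` will be the block containing `i`.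
    have hex : ∀ i, ∃ k, i ≤ M (k + 1) := fun i => ⟨i, (Nat.le_succ i).trans (hM.id_le _)⟩
    obtain ⟨idx, hidx⟩ : ∃ idx : ℕ → ℕ, ∀ k, ∀ i ∈ Set.Ioc (M k) (M (k + 1)), idx i = k := by
      refine ⟨fun i => Nat.find (hex i), fun k i hi => ?_⟩
      refine le_antisymm (Nat.find_min' _ hi.2) (not_lt.1 fun hlt => ?_)
      exact absurd ((Nat.find_spec (hex i)).trans (hM.monotone (Nat.succ_le_of_lt hlt)))
        (not_le.2 hi.1)
    have hfin : ∀ k, ∃ c : Fin 2, ((c : ℕ) : ℝ) = b k := fun k => by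
      rcases hb k with h | h
      exacts [⟨0, by simp [h]⟩, ⟨1, by simp [h]⟩]
    choose c hc using hfin
    refine ⟨fun i => c (idx i), fun k i hi j hj => ?_,
      hasSum_blocks (a := fun i => c (idx i)) hM0 hM (fun k i hi => ?_) hb⟩
    · simp only [hidx k i hi, hidx k j hj]
    · simp only [hidx k i hi, hc]

/-- The block boundaries `0, 2, 4, 8, 16, …`. -/
def cubeCut : ℕ → ℕ
  | 0 => 0
  | k + 1 => 2 ^ (k + 1)

/-- The block boundaries `0, 3, 5, 7, 9, …`. -/
def projCut : ℕ → ℕ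
  | 0 => 0
  | k + 1 => 2 * k + 3

theorem cubeCut_add_two_le (k : ℕ) : cubeCut k + 2 ≤ cubeCut (k + 1) := by
  rcases k with _ | k
  · simp [cubeCut]
  · have := Nat.one_le_two_pow (n := k)
    simp only [cubeCut, pow_succ]
    omega

theorem projCut_add_two_le (k : ℕ) : projCut k + 2 ≤ projCut (k + 1) := by
  rcases k with _ | k <;> simp only [projCut] <;> omega

theorem SCube_eq : SCube = cantorSet fun k => (1 / 2 : ℝ) ^ cubeCut k := by
  rw [← blockSet_eq_cantorSet rfl (strictMono_nat_of_lt_succ fun k => by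
    linarith [cubeCut_add_two_le k])]
  ext s
  refine exists_congr fun a => ?_
  rw [← and_assoc]
  refine and_congr_left fun _ => ⟨?_, fun h => ⟨?_, fun k hk => ?_⟩⟩
  · rintro ⟨h1, h2⟩ k
    -- Block 0 is (0, 2] and is described by the separate condition `a 1 = a 2`; block k+1 is
    -- (2^(k+1), 2^(k+2)].
    rcases k with _ | k
    · have h3 : ∀ i ∈ Set.Ioc (cubeCut 0) (cubeCut (0 + 1)), a i = a 2 := by
        rintro i ⟨hi, hi'⟩
        simp only [cubeCut, zero_add, pow_one] at hi hi'
        interval_cases i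
        exacts [h1, rfl]
      exact fun i hi j hj => (h3 i hi).trans (h3 j hj).symm
    · exact h2 (k + 1) (Nat.le_add_left 1 k)
  · exact h 0 1 ⟨by simp [cubeCut], by simp [cubeCut]⟩ 2 ⟨by simp [cubeCut], by simp [cubeCut]⟩
  · obtain ⟨k, rfl⟩ := Nat.exists_eq_add_of_le' hk
    exact h (k + 1)

theorem SProj_eq : SProj = cantorSet fun k => (1 / 2 : ℝ) ^ projCut k := by
  rw [← blockSet_eq_cantorSet rfl (strictMono_nat_of_lt_succ fun k => by
    linarith [projCut_add_two_le k])]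
  ext s
  refine exists_congr fun a => ?_
  rw [← and_assoc, ← and_assoc]
  refine and_congr_left fun _ => ⟨?_, fun h => ⟨⟨?_, ?_⟩, fun k hk => ?_⟩⟩
  · rintro ⟨⟨h1, h2⟩, h3⟩ k
    rcases k with _ | k
    · have h4 : ∀ i ∈ Set.Ioc (projCut 0) (projCut (0 + 1)), a i = a 3 := by
        rintro i ⟨hi, hi'⟩
        simp only [projCut, mul_zero, zero_add] at hi hi'
        interval_cases i
        exacts [h1.trans h2, h2, rfl]
      exact fun i hi j hj => (h4 i hi).trans (h4 j hj).symm
    · have h4 : ∀ i ∈ Set.Ioc (projCut (k + 1)) (projCut (k + 1 + 1)), a i = a (2 * (k + 2)) := by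
        rintro i ⟨hi, hi'⟩
        simp only [projCut] at hi hi'
        obtain rfl | rfl : i = 2 * (k + 2) ∨ i = 2 * (k + 2) + 1 := by omega
        exacts [rfl, (h3 (k + 2) (Nat.le_add_left 2 k)).symm]
      exact fun i hi j hj => (h4 i hi).trans (h4 j hj).symm
  · exact h 0 1 ⟨by simp [projCut], by simp [projCut]⟩ 2 ⟨by simp [projCut], by simp [projCut]⟩
  · exact h 0 2 ⟨by simp [projCut], by simp [projCut]⟩ 3 ⟨by simp [projCut], by simp [projCut]⟩
  · obtain ⟨k, rfl⟩ := Nat.exists_eq_add_of_le' hk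
    exact h (k + 1) _ ⟨by simp only [projCut]; omega, by simp only [projCut]; omega⟩ _
      ⟨by simp only [projCut]; omega, by simp only [projCut]; omega⟩

theorem four_mul_half_pow_le {m n : ℕ} (h : m + 2 ≤ n) : 4 * (1 / 2 : ℝ) ^ n ≤ (1 / 2) ^ m := by
  have h1 := antitone_half_pow h
  simp only [pow_add] at h1
  linarith

theorem half_pow_mem_range (n : ℕ) : (1 / 2 : ℝ) ^ n ∈ (algebraMap ℚ ℝ).range :=
  ⟨(1 / 2) ^ n, by simp⟩

/-! ### The two gauge functions -/

theorem hCube_zero : hCube 0 = 0 := by simp [hCube]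

theorem hCube_half_pow (n : ℕ) : hCube ((1 / 2) ^ n) = 1 / n := by
  rw [hCube, one_div_pow, one_div_one_div, Real.logb_pow, Real.logb_self_eq_one one_lt_two, mul_one]

theorem logb_one_div_pos {x : ℝ} (hx : 0 < x) (hx1 : x < 1) : 0 < Real.logb 2 (1 / x) :=
  Real.logb_pos one_lt_two (one_lt_one_div hx hx1)

theorem monotoneOn_hCube : MonotoneOn hCube (Set.Ico 0 1) := by
  intro x hx y hy hxy
  rcases hx.1.eq_or_lt with rfl | hx0
  · rw [hCube_zero]
    rcases hxy.eq_or_lt with rfl | hy0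
    · rw [hCube_zero]
    · exact one_div_nonneg.2 (logb_one_div_pos hy0 hy.2).le
  · have hy0 := hx0.trans_le hxy
    refine one_div_le_one_div_of_le (logb_one_div_pos hy0 hy.2) ?_
    exact Real.logb_le_logb_of_le one_lt_two (by positivity) (one_div_le_one_div_of_le hx0 hxy)

theorem isGauge_hCube : IsGauge hCube := by
  refine ⟨1, one_pos, fun x hx => ?_, monotoneOn_hCube, fun x hx => ?_⟩
  · rw [← hCube_zero]
    exact monotoneOn_hCube ⟨le_rfl, one_pos⟩ hx hx.1
  · rcases hx.1.eq_or_lt with rfl | hx0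
    · rw [← continuousWithinAt_Ioi_iff_Ici, ContinuousWithinAt, hCube_zero]
      have h1 : Tendsto (fun x : ℝ => Real.logb 2 (1 / x)) (𝓝[>] 0) atTop := by
        simp_rw [one_div]
        exact (Real.tendsto_logb_atTop one_lt_two).comp tendsto_inv_nhdsGT_zero
      exact (tendsto_inv_atTop_zero.comp h1).congr fun x => (one_div _).symm
    · refine ContinuousAt.continuousWithinAt ?_
      have h1 : ContinuousAt (fun x : ℝ => 1 / x) x := by fun_prop (disch := exact hx0.ne')
      have h2 : ContinuousAt (fun x : ℝ => Real.logb 2 (1 / x)) x :=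
        (Real.continuousAt_logb (by positivity)).comp h1
      exact continuousAt_const.div h2 (logb_one_div_pos hx0 hx.2).ne'

/-- The concave logarithm lies above its chord between 1/2 and 1. -/
theorem log_one_sub_ge {t : ℝ} (ht0 : 0 ≤ t) (ht : t ≤ 1 / 2) :
    -(2 * t * Real.log 2) ≤ Real.log (1 - t) := by
  have h := strictConcaveOn_log_Ioi.concaveOn.2 (show (1 : ℝ) ∈ Set.Ioi 0 by simp)
    (show (1 / 2 : ℝ) ∈ Set.Ioi 0 by simp) (show 0 ≤ 1 - 2 * t by linarith)
    (show 0 ≤ 2 * t by linarith) (by ring)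
  simp only [smul_eq_mul, Real.log_one, mul_zero, zero_add, mul_one, one_div, Real.log_inv] at h
  rw [show 1 - 2 * t + 2 * t * 2⁻¹ = 1 - t by ring] at h
  linarith

/-- This is the decrease of log y / y for y ≥ e, at y = 1/c and y = 1/v; 1/c ≥ 3 > e. -/
theorem mul_logb_one_div_le {v c : ℝ} (hv : 0 < v) (hvc : v ≤ c) (hc : c ≤ 1 / 3) :
    v * Real.logb 2 (1 / v) ≤ c * Real.logb 2 (1 / c) := by
  have hc0 : 0 < c := hv.trans_le hvc
  have h3 : Real.exp 1 ≤ 3 := (Real.exp_one_lt_d9.trans (by norm_num)).le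
  have hc' : (3 : ℝ) ≤ 1 / c := by rw [le_div_iff₀ hc0]; linarith
  have hcv : 1 / c ≤ 1 / v := one_div_le_one_div_of_le hv hvc
  have h := Real.log_div_self_antitoneOn (show 1 / c ∈ {x | Real.exp 1 ≤ x} from h3.trans hc')
    (show 1 / v ∈ {x | Real.exp 1 ≤ x} from h3.trans (hc'.trans hcv)) hcv
  simp only [div_div_eq_mul_div, div_one] at h
  simp only [Real.logb, mul_div_assoc']
  refine div_le_div_of_nonneg_right ?_ (Real.log_pos one_lt_two).le
  linarith

/-- With A = log₂(1/a) and t = (v + w)/a, both sides are compared with 2t/A²: the left is at most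
this because log₂(1/(a - v - w)) ≤ A + 2t, and the right is at least this term by term in v and w.
-/
theorem hCube_concave {a v w : ℝ} (ha0 : 0 < a) (ha : a ≤ 1 / 4) (hv : v ∈ Set.Icc 0 (a ^ 2))
    (hw : w ∈ Set.Icc 0 (a ^ 2)) : hCube a - hCube (a - v - w) ≤ (hCube v + hCube w) / 2 := by
  set A := Real.logb 2 (1 / a) with hA
  have hA2 : 2 ≤ A := by
    rw [hA, Real.le_logb_iff_rpow_le one_lt_two (by positivity), le_div_iff₀ ha0]
    norm_num
    linarith
  have hA0 : 0 < A := by linarith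
  have hasq : a ^ 2 ≤ a / 4 := by nlinarith
  -- From u log₂(1/u) ≤ 2a²A one gets `hCube u / 2` ≥ u/(4a²A) for u > 0; this suffices since A ≥ 2
  -- ≥ 8a.
  have hone : ∀ u ∈ Set.Icc 0 (a ^ 2), 2 * u / (a * A ^ 2) ≤ hCube u / 2 := by
    rintro u ⟨hu0, hu⟩
    rcases hu0.eq_or_lt with rfl | hu0
    · simp [hCube_zero]
    have hL := logb_one_div_pos hu0 (by linarith : u < 1)
    have h1 := mul_logb_one_div_le hu0 hu (by linarith)
    have h2 : Real.logb 2 (1 / a ^ 2) = 2 * A := by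
      rw [hA, ← one_div_pow, Real.logb_pow]; norm_num
    rw [h2] at h1
    rw [hCube, div_div, div_le_div_iff₀ (by positivity) (by positivity)]
    nlinarith [mul_pos ha0 hA0]
  set t := (v + w) / a with ht
  have hta : v + w = t * a := by rw [ht]; field_simp
  have ht0 : 0 ≤ t := div_nonneg (add_nonneg hv.1 hw.1) ha0.le
  have ht1 : t ≤ 1 / 2 := by
    rw [ht, div_le_iff₀ ha0]
    linarith [hv.2, hw.2]
  have hB : Real.logb 2 (1 / (a - v - w)) ≤ A + 2 * t := by
    have h1 : a - v - w = a * (1 - t) := by linarith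
    have h2 : 0 < 1 - t := by linarith
    have h3 := log_one_sub_ge ht0 ht1
    have h4 := Real.log_pos one_lt_two
    rw [hA, h1, one_div, one_div, Real.logb_inv, Real.logb_inv, Real.logb_mul ha0.ne' h2.ne']
    have h5 : -(2 * t) ≤ Real.logb 2 (1 - t) := by
      rw [Real.logb, le_div_iff₀ h4]
      linarith
    linarith
  have hpos : 0 < a - v - w := by nlinarith
  have hBA : 0 < Real.logb 2 (1 / (a - v - w)) :=
    logb_one_div_pos hpos (by linarith [hv.1, hw.1])
  have h1 : hCube a - hCube (a - v - w) ≤ 2 * t / A ^ 2 := by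
    have h2 : 1 / (A + 2 * t) ≤ hCube (a - v - w) := one_div_le_one_div_of_le hBA hB
    have h3 : 1 / A - 1 / (A + 2 * t) ≤ 2 * t / A ^ 2 := by
      rw [div_sub_div _ _ hA0.ne' (by positivity), div_le_div_iff₀ (by positivity) (by positivity)]
      nlinarith [mul_nonneg ht0 hA0.le, mul_nonneg (mul_nonneg ht0 ht0) hA0.le]
    have h4 : hCube a = 1 / A := rfl
    linarith
  have h2 : 2 * t / A ^ 2 = 2 * v / (a * A ^ 2) + 2 * w / (a * A ^ 2) := by
    rw [ht]
    field_simp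
  linarith [hone v hv, hone w hw]

theorem isCantorGauge_cube : IsCantorGauge (fun k => (1 / 2 : ℝ) ^ cubeCut k) hCube where
  zero := by simp [cubeCut]
  pos k := by positivity
  quarter k := four_mul_half_pow_le (cubeCut_add_two_le k)
  rational k := half_pow_mem_range _
  gauge := isGauge_hCube
  mono := monotoneOn_hCube
  h_zero := hCube_zero
  h_succ k := by
    rw [hCube_half_pow, cubeCut, one_div_pow]
    push_cast
    rfl
  concave k v w hv hw := by
    -- Block ends double, so e_{k+2} is the square of e_{k+1}.
    have h1 : (1 / 2 : ℝ) ^ cubeCut (k + 2) = ((1 / 2 : ℝ) ^ cubeCut (k + 1)) ^ 2 := by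
      rw [← pow_mul]
      rfl
    simp only [h1] at hv hw
    refine hCube_concave (by positivity) ?_ hv hw
    have h2 := four_mul_half_pow_le (cubeCut_add_two_le k)
    have h3 := pow_le_one₀ (n := cubeCut k) (by norm_num : (0 : ℝ) ≤ 1 / 2) (by norm_num)
    linarith

theorem monotone_hProj : Monotone hProj := fun _ _ h => Real.sqrt_le_sqrt (by linarith)

theorem continuous_hProj : Continuous hProj := by
  unfold hProj
  fun_prop

/-- Write m, p, q for the gauges of a, v, w. Since p, q ≤ m/2, one has (m - (p + q)/2)² ≤ m² - p² -
q² = 2(a - v - w). -/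
theorem hProj_concave {a v w : ℝ} (ha : 0 ≤ a) (hv : v ∈ Set.Icc 0 (a / 4))
    (hw : w ∈ Set.Icc 0 (a / 4)) : hProj a - hProj (a - v - w) ≤ (hProj v + hProj w) / 2 := by
  have hsq : ∀ x, 0 ≤ x → hProj x ^ 2 = 2 * x := fun x hx => Real.sq_sqrt (by linarith)
  have hnn : ∀ x, 0 ≤ hProj x := fun x => Real.sqrt_nonneg _
  have hle : ∀ x ∈ Set.Icc 0 (a / 4), hProj x ≤ hProj a / 2 := by
    rintro x ⟨hx0, hx⟩
    refine abs_le_of_sq_le_sq' ?_ (by linarith [hnn a]) |>.2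
    rw [div_pow, hsq x hx0, hsq a ha]
    linarith
  have h1 : hProj a - (hProj v + hProj w) / 2 ≤ hProj (a - v - w) := by
    refine (le_abs_self _).trans (Real.abs_le_sqrt ?_)
    have h2 := hle v hv
    have h3 := hle w hw
    nlinarith [hsq a ha, hsq v hv.1, hsq w hw.1, mul_le_mul_of_nonneg_left h2 (hnn v),
      mul_le_mul_of_nonneg_left h3 (hnn w), mul_le_mul_of_nonneg_left h2 (hnn w)]
  linarith

theorem isCantorGauge_proj : IsCantorGauge (fun k => (1 / 2 : ℝ) ^ projCut k) hProj where
  zero := by simp [projCut]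
  pos k := by positivity
  quarter k := four_mul_half_pow_le (projCut_add_two_le k)
  rational k := half_pow_mem_range _
  gauge := ⟨1, one_pos, fun x _ => Real.sqrt_nonneg _, monotone_hProj.monotoneOn _,
    fun x _ => continuous_hProj.continuousWithinAt⟩
  mono := monotone_hProj.monotoneOn _
  h_zero := by simp [hProj]
  h_succ k := by
    have h1 : 2 * (1 / 2 : ℝ) ^ projCut (k + 1) = ((1 / 2) ^ (k + 1)) ^ 2 := by
      rw [projCut]
      ring
    rw [hProj, h1, Real.sqrt_sq (by positivity)]
  concave k v w hv hw := by
    have h1 : (1 / 2 : ℝ) ^ projCut (k + 2) = (1 / 2 : ℝ) ^ projCut (k + 1) / 4 := by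
      rw [projCut, projCut]
      ring
    simp only [h1] at hv hw
    exact hProj_concave (by positivity) hv hw

/-- The squared ratio is (q+1)²/(q²+q+1) = 1 + q/(q²+q+1), which tends to 1. -/
theorem isEquivalent_hProj {q : ℕ → ℕ} (hq : Tendsto q atTop atTop) :
    Asymptotics.IsEquivalent atTop
      (fun n => hProj (1 / ((2 * (q n ^ 2 + q n + 1) : ℕ) : ℝ)))
      (fun n => 1 / ((q n + 1 : ℕ) : ℝ)) := by
  refine Asymptotics.isEquivalent_of_tendsto_one ?_
  have h1 : Tendsto (fun n => 1 / ((q n : ℝ) + 1)) atTop (𝓝 0) :=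
    tendsto_one_div_add_atTop_nhds_zero_nat.comp hq
  have h2 : Tendsto (fun n => (q n : ℝ) / ((q n : ℝ) ^ 2 + q n + 1)) atTop (𝓝 0) := by
    refine squeeze_zero (fun n => by positivity) (fun n => ?_) h1
    rw [div_le_div_iff₀ (by positivity) (by positivity)]
    nlinarith
  have h3 := (h2.const_add 1).sqrt
  rw [add_zero, Real.sqrt_one] at h3
  refine h3.congr fun n => ?_
  have h4 : 1 + (q n : ℝ) / ((q n : ℝ) ^ 2 + q n + 1) =
      2 * (1 / ((2 * (q n ^ 2 + q n + 1) : ℕ) : ℝ)) * ((q n : ℝ) + 1) ^ 2 := by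
    push_cast
    field_simp
    ring
  rw [h4, Real.sqrt_mul (by positivity), Real.sqrt_sq (by positivity)]
  simp [hProj]

end GraphLimits

/-! ### The two examples -/

theorem mainTheorem6 :
    (GraphLimits.gaugeMeasure unitInterval GraphLimits.hCube
        ((fun x : unitInterval => (x : ℝ)) ⁻¹' GraphLimits.SCube) = 1 ∧
      GraphLimits.IsEuclideanLimit (V := fun n => Fin (n + 1) → Fin 2)
        (fun n => GraphLimits.hypercube (n + 1)) (fun n => ((n + 1 : ℕ) : ℝ))
        (GraphLimits.differenceGraphoning GraphLimits.SCube GraphLimits.hCube)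
        GraphLimits.hCube) ∧
    (GraphLimits.gaugeMeasure unitInterval GraphLimits.hProj
        ((fun x : unitInterval => (x : ℝ)) ⁻¹' GraphLimits.SProj) = 1 ∧
      ∀ (P L : ℕ → Type*) [∀ n, Finite (P n)] [∀ n, Finite (L n)]
        [∀ n, Membership (P n) (L n)] [∀ n, Configuration.ProjectivePlane (P n) (L n)]
        (q : ℕ → ℕ), (∀ n, Configuration.ProjectivePlane.order (P n) (L n) = q n) →
        Filter.Tendsto q Filter.atTop Filter.atTop →
        GraphLimits.IsEuclideanLimit (V := fun n => P n ⊕ L n)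
          (fun n => GraphLimits.incidenceGraph (P n) (L n)) (fun n => (q n : ℝ) + 1)
          (GraphLimits.differenceGraphoning GraphLimits.SProj GraphLimits.hProj)
          GraphLimits.hProj) := by
  rw [GraphLimits.SCube_eq, GraphLimits.SProj_eq]
  refine ⟨⟨GraphLimits.isCantorGauge_cube.gaugeMeasure_preimage_cantorSet, ?_⟩,
    GraphLimits.isCantorGauge_proj.gaugeMeasure_preimage_cantorSet, ?_⟩
  · refine GraphLimits.isCantorGauge_cube.isEuclideanLimit
      (fun n => GraphLimits.isSparseRegular_hypercube n.succ_pos) (tendsto_add_atTop_nat 1) ?_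
    -- For hypercubes the growth condition is an exact equality.
    have h : ∀ n : ℕ, GraphLimits.hCube (1 / (Nat.card (Fin (n + 1) → Fin 2) : ℝ)) =
        1 / ((n + 1 : ℕ) : ℝ) := by
      intro n
      rw [GraphLimits.card_hypercube, Nat.cast_pow, Nat.cast_ofNat, ← one_div_pow,
        GraphLimits.hCube_half_pow]
    simp_rw [h]
    rfl
  · intro P L _ _ _ _ q hPq hq
    have h := GraphLimits.isCantorGauge_proj.isEuclideanLimit (V := fun n => P n ⊕ L n)
      (G := fun n => GraphLimits.incidenceGraph (P n) (L n)) (d := fun n => q n + 1)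
      (fun n => hPq n ▸ GraphLimits.isSparseRegular_incidenceGraph)
      ((tendsto_add_atTop_nat 1).comp hq) ?_
    · simpa only [Nat.cast_add, Nat.cast_one] using h
    · have h2 : ∀ n, Nat.card (P n ⊕ L n) = 2 * (q n ^ 2 + q n + 1) := fun n => by
        rw [GraphLimits.card_incidenceGraph, hPq]
      simp_rw [h2]
      exact GraphLimits.isEquivalent_hProj hq
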